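/- **Conventions.** A unital locally $C^*$-algebra is a complete Hausdorff unital complex topological $*$-algebra $\mathcal A$ whose topology is determined by a family $\{p_\lambda\}_{\lambda\in\Lambda}$ of $C^*$-seminorms indexed by a nonempty directed poset $\Lambda$, with $p_\lambda\le p_\mu$ whenever $\lambda\le\mu$. Write $\mathcal A_\lambda$ for the $C^*$-algebra $\mathcal A/\{a: p_\lambda(a)=0\}$ with the norm induced by $p_\lambda$, and $p_\lambda^n$ for the $C^*$-seminorm on $M_n(\mathcal A)$ given by the norm of the image in $M_n(\mathcal A_\lambda)$. For $a\in M_n(\mathcal A)$ write $a=_\lambda 0$ if $p^n_\lambda(a)=0$, and $a\ge_\lambda 0$ if $a=b^*b+c$ with $b,c\in M_n(\mathcal A)$ and $c=_\lambda0$. A local operator system in $\mathcal A$ is a self-adjoint linear subspace $\mathcal S\subseteq\mathcal A$ containing the unit; it generates $\mathcal A$ if the $*$-subalgebra generated by $\mathcal S$ is dense in $\mathcal A$. Let $\mathcal H\neq 0$ be a complex Hilbert space. A linear map $\varphi:\mathcal A\to B(\mathcal H)$ is local completely positive (local $\mathcal{CP}$) if there is $\lambda\in\Lambda$ such that for all $n\ge1$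 and all $[a_{ij}]\in M_n(\mathcal A)$: $[\varphi(a_{ij})]\ge0$ in $B(\mathcal H^{\oplus n})$ if $[a_{ij}]\ge_\lambda0$, and $[\varphi(a_{ij})]=0$ if $[a_{ij}]=_\lambda0$. A (unital) local representation of $\mathcal A$ on $\mathcal H$ is a unital $*$-morphism $\pi:\mathcal A\to B(\mathcal H)$ for which there is $\lambda\in\Lambda$ with $\|\pi(a)\|\le p_\lambda(a)$ for all $a\in\mathcal A$; it is irreducible if the commutant of $\pi(\mathcal A)$ in $B(\mathcal H)$ is $\mathbb C I$. If $\mathcal S$ generates $\mathcal A$, a local boundary representation of $\mathcal A$ on $\mathcal H$ for $\mathcal S$ is an irreducible local representation $\pi:\mathcal A\to B(\mathcal H)$ which is the unique local $\mathcal{CP}$-map $\mathcal A\to B(\mathcal H)$ extending $\pi|_{\mathcal S}$. **Theorem.** Let $\mathcal A_1$ and $\mathcal A_2$ be unital locally $C^*$-algebras with topologies determined by families of $C^*$-seminorms $\{p_\lambda\}_{\lambda\in\Lambda}$ and $\{q_\lambda\}_{\lambda\in\Lambda}$ respectively (same index set), and let $\mathcal S_1\subseteq\mathcal A_1$ and $\mathcal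 S_2\subseteq\mathcal A_2$ be local operator systems generating $\mathcal A_1$ and $\mathcal A_2$. Let $\Phi:\mathcal S_1\to\mathcal S_2$ be a unital surjective linear map that is local completely isometric, i.e. $q_\lambda^n([\Phi(a_{ij})])=p_\lambda^n([a_{ij}])$ for all $\lambda\in\Lambda$, $n\ge1$ and $[a_{ij}]\in M_n(\mathcal S_1)$. Then for every local boundary representation $\pi_1:\mathcal A_1\to B(\mathcal H)$ for $\mathcal S_1$ there exists a local boundary representation $\pi_2:\mathcal A_2\to B(\mathcal H)$ for $\mathcal S_2$ such that $\pi_2\circ\Phi=\pi_1|_{\mathcal S_1}$. -/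

import Mathlib

/-- A C⋆-seminorm on a unital complex ⋆-algebra `A`: a seminorm `p` with `p (ab) ≤ p a * p b` and
`p (a⋆ a) = (p a)²`. -/
structure CStarSeminorm (A : Type*) [Ring A] [StarRing A] [Algebra ℂ A]
    extends Seminorm ℂ A where
  mul_le' : ∀ a b : A, toSeminorm (a * b) ≤ toSeminorm a * toSeminorm b
  star_mul_self' : ∀ a : A, toSeminorm (star a * a) = toSeminorm a ^ 2

namespace CStarSeminorm

section Basic

variable {A : Type*} [Ring A] [StarRing A] [Algebra ℂ A]

noncomputable instance : CoeFun (CStarSeminorm A) (fun _ => A → ℝ) := ⟨fun p => p.toSeminorm⟩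

theorem star_le (p : CStarSeminorm A) (a : A) : p (star a) ≤ p a := by
  have h1 := p.star_mul_self' (star a)
  have h2 := p.mul_le' a (star a)
  rw [star_star] at h1
  rw [h1] at h2
  rcases (apply_nonneg p.toSeminorm (star a)).eq_or_lt with h0 | h0
  · rw [← h0]
    exact apply_nonneg p.toSeminorm a
  · exact le_of_mul_le_mul_right (by rw [← sq]; exact h2) h0

/-- The algebra `A` with the (possibly non-Hausdorff) topology of the single C⋆-seminorm `p`. -/
def Space (_ : CStarSeminorm A) : Type _ := A

variable (p : CStarSeminorm A)

instance : Ring p.Space := inferInstanceAs (Ring A)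

instance : StarRing p.Space := inferInstanceAs (StarRing A)

instance : Algebra ℂ p.Space := inferInstanceAs (Algebra ℂ A)

instance [StarModule ℂ A] : StarModule ℂ p.Space := inferInstanceAs (StarModule ℂ A)

noncomputable instance : SeminormedRing p.Space where
  toRing := inferInstance
  toPseudoMetricSpace := p.toSeminorm.toSeminormedAddCommGroup.toPseudoMetricSpace
  norm := p.toSeminorm
  dist_eq := p.toSeminorm.toSeminormedAddCommGroup.dist_eq
  norm_mul_le := p.mul_le'

theorem norm_space (a : A) : ‖(show p.Space from a)‖ = p a := rfl

noncomputable instance : NormedAlgebra ℂ p.Space where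
  norm_smul_le c a := (map_smul_eq_mul p.toSeminorm c a).le

instance : NormedStarGroup p.Space where
  norm_star_le a := p.star_le a

/-- The C⋆-algebra `A_p` attached to a C⋆-seminorm `p`: the Hausdorff completion of `A` with respect
to `p`. The kernel of `A → A_p` is `{a | p a = 0}` and the norm of the class of `a` is `p a`. (When
`p` is one of the seminorms of a locally C⋆-algebra `A`, the quotient `A / {a | p a = 0}` is already
complete, so that `A_p` is this quotient.) -/
def Quot : Type _ := UniformSpace.Completion p.Space

noncomputable instance : NormedRing p.Quot := inferInstanceAs (NormedRing (UniformSpace.Completion p.Space))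

instance : CompleteSpace p.Quot := inferInstanceAs (CompleteSpace (UniformSpace.Completion p.Space))

noncomputable instance : NormedSpace ℂ p.Quot :=
  inferInstanceAs (NormedSpace ℂ (UniformSpace.Completion p.Space))

/-- The canonical morphism `A → A_p`. -/
noncomputable def toQuot (a : A) : p.Quot := ((show p.Space from a : p.Space) : UniformSpace.Completion p.Space)

theorem denseRange_toQuot : DenseRange p.toQuot := UniformSpace.Completion.denseRange_coe (α := p.Space)

theorem norm_toQuot (a : A) : ‖p.toQuot a‖ = p a := UniformSpace.Completion.norm_coe (E := p.Space) a

theorem toQuot_add (a b : A) : p.toQuot (a + b) = p.toQuot a + p.toQuot b :=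
  UniformSpace.Completion.coe_add (α := p.Space) a b

theorem toQuot_mul (a b : A) : p.toQuot (a * b) = p.toQuot a * p.toQuot b :=
  UniformSpace.Completion.coe_mul (α := p.Space) a b

theorem toQuot_smul (c : ℂ) (a : A) : p.toQuot (c • a) = c • p.toQuot a :=
  UniformSpace.Completion.coe_smul (X := p.Space) c a

noncomputable instance : NormedAlgebra ℂ p.Quot where
  __ := Algebra.ofModule (R := ℂ) (A := p.Quot)
    (fun c x y => by
      refine p.denseRange_toQuot.induction_on₂ (isClosed_eq ?_ ?_) (fun a b => ?_) x y
      · exact (continuous_fst.const_smul c).mul continuous_snd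
      · exact (continuous_fst.mul continuous_snd).const_smul c
      · rw [← toQuot_smul, ← toQuot_mul, ← toQuot_mul, ← toQuot_smul, smul_mul_assoc])
    (fun c x y => by
      refine p.denseRange_toQuot.induction_on₂ (isClosed_eq ?_ ?_) (fun a b => ?_) x y
      · exact continuous_fst.mul (continuous_snd.const_smul c)
      · exact (continuous_fst.mul continuous_snd).const_smul c
      · rw [← toQuot_smul, ← toQuot_mul, ← toQuot_mul, ← toQuot_smul, mul_smul_comm])
  norm_smul_le := norm_smul_le

noncomputable instance : Star p.Quot :=
  ⟨UniformSpace.Completion.map (star : p.Space → p.Space)⟩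

theorem toQuot_star (a : A) : p.toQuot (star a) = star (p.toQuot a) :=
  (UniformSpace.Completion.map_coe (α := p.Space) (β := p.Space)
    (star_isometry (E := p.Space)).uniformContinuous a).symm

theorem continuous_star_quot : Continuous (star : p.Quot → p.Quot) :=
  UniformSpace.Completion.continuous_map (f := (star : p.Space → p.Space))

noncomputable instance : StarRing p.Quot where
  star_involutive x := by
    refine p.denseRange_toQuot.induction_on x
      (isClosed_eq (p.continuous_star_quot.comp p.continuous_star_quot) continuous_id) fun a => ?_
    rw [← toQuot_star, ← toQuot_star, star_star]
  star_mul x y := by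
    refine p.denseRange_toQuot.induction_on₂ (isClosed_eq ?_ ?_) (fun a b => ?_) x y
    · exact p.continuous_star_quot.comp (continuous_fst.mul continuous_snd)
    · exact (p.continuous_star_quot.comp continuous_snd).mul
        (p.continuous_star_quot.comp continuous_fst)
    · rw [← toQuot_mul, ← toQuot_star, star_mul, toQuot_mul, toQuot_star, toQuot_star]
  star_add x y := by
    refine p.denseRange_toQuot.induction_on₂ (isClosed_eq ?_ ?_) (fun a b => ?_) x y
    · exact p.continuous_star_quot.comp (continuous_fst.add continuous_snd)
    · exact (p.continuous_star_quot.comp continuous_fst).add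
        (p.continuous_star_quot.comp continuous_snd)
    · rw [← toQuot_add, ← toQuot_star, star_add, toQuot_add, toQuot_star, toQuot_star]

instance : CStarRing p.Quot where
  norm_mul_self_le x := by
    refine p.denseRange_toQuot.induction_on x (isClosed_le ?_ ?_) fun a => ?_
    · exact continuous_norm.mul continuous_norm
    · exact continuous_norm.comp (p.continuous_star_quot.mul continuous_id)
    · rw [← toQuot_star, ← toQuot_mul, norm_toQuot, norm_toQuot, p.star_mul_self', sq]

end Basic

section Matrix

variable {A : Type*} [Ring A] [StarRing A] [Algebra ℂ A] [StarModule ℂ A]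

instance (p : CStarSeminorm A) : StarModule ℂ p.Quot where
  star_smul c x := by
    refine p.denseRange_toQuot.induction_on x (isClosed_eq ?_ ?_) fun a => ?_
    · exact p.continuous_star_quot.comp (continuous_const_smul c)
    · exact p.continuous_star_quot.const_smul (star c)
    · rw [← toQuot_smul, ← toQuot_star, star_smul, toQuot_smul, toQuot_star]

noncomputable instance (p : CStarSeminorm A) : CStarAlgebra p.Quot where

noncomputable instance (p : CStarSeminorm A) : PartialOrder p.Quot :=
  CStarAlgebra.spectralOrder p.Quot

instance (p : CStarSeminorm A) : StarOrderedRing p.Quot :=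
  CStarAlgebra.spectralOrderedRing p.Quot

/-- The C⋆-seminorm `pⁿ` on `M_n(A)` associated with `p`: the C⋆-norm of the image of the matrix in
`M_n(A_p)`. -/
noncomputable def matrixSeminorm (p : CStarSeminorm A) (n : ℕ) (M : Matrix (Fin n) (Fin n) A) : ℝ :=
  ‖CStarMatrix.ofMatrix (M.map p.toQuot)‖

/-- `M ≥_p 0` in `M_n(A)`: `M = b⋆ b + c` where `pⁿ c = 0`. -/
def MatrixNonneg (p : CStarSeminorm A) (n : ℕ) (M : Matrix (Fin n) (Fin n) A) : Prop :=
  ∃ b c : Matrix (Fin n) (Fin n) A, p.matrixSeminorm n c = 0 ∧ M = star b * b + c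

end Matrix

end CStarSeminorm

/-- `A` is a unital locally C⋆-algebra whose topology is determined by the upward filtered family of
C⋆-seminorms `p`. (Continuity of the algebraic operations follows from `withSeminorms`.) -/
structure IsLocallyCStarAlgebra {A Λ : Type*} [Ring A] [StarRing A] [Algebra ℂ A] [UniformSpace A]
    [Preorder Λ] (p : Λ → CStarSeminorm A) : Prop where
  nonempty_index : Nonempty Λ
  directed_index : ∀ l m : Λ, ∃ k, l ≤ k ∧ m ≤ k
  mono : ∀ l m : Λ, l ≤ m → ∀ a, p l a ≤ p m a
  isUniformAddGroup : IsUniformAddGroup A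
  withSeminorms : WithSeminorms (fun l => (p l).toSeminorm)
  t2Space : T2Space A
  completeSpace : CompleteSpace A

/-- A local operator system: a self-adjoint linear subspace that contains the unit. -/
structure LocalOperatorSystem (A : Type*) [Ring A] [StarRing A] [Algebra ℂ A]
    extends Submodule ℂ A where
  one_mem' : (1 : A) ∈ carrier
  star_mem' : ∀ a ∈ carrier, star a ∈ carrier

namespace LocalOperatorSystem

variable {A : Type*} [Ring A] [StarRing A] [Algebra ℂ A]

/-- The unit, as an element of the local operator system. -/
def unit (S : LocalOperatorSystem A) : S.toSubmodule := ⟨1, S.one_mem'⟩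

/-- `S` generates `A`: the closed ⋆-subalgebra of `A` generated by `S` is `A`. -/
def Generates [StarModule ℂ A] [TopologicalSpace A] (S : LocalOperatorSystem A) : Prop :=
  closure (StarAlgebra.adjoin ℂ (S.carrier : Set A) : Set A) = Set.univ

end LocalOperatorSystem

section Maps

variable {A Λ : Type*} [Ring A] [StarRing A] [Algebra ℂ A] [StarModule ℂ A]
  {H : Type*} [NormedAddCommGroup H] [InnerProductSpace ℂ H]

/-- The operator on `H ⊕ ⋯ ⊕ H` (the Hilbert space direct sum of `n` copies of `H`) given by an
`n × n` matrix of operators on `H`. -/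
noncomputable def blockOperator (n : ℕ) (M : Matrix (Fin n) (Fin n) (H →L[ℂ] H)) :
    PiLp 2 (fun _ : Fin n => H) →L[ℂ] PiLp 2 (fun _ : Fin n => H) :=
  ((PiLp.continuousLinearEquiv 2 ℂ (fun _ : Fin n => H)).symm :
      (Fin n → H) →L[ℂ] PiLp 2 (fun _ : Fin n => H)) ∘L
    (ContinuousLinearMap.pi fun i => ∑ j, (M i j) ∘L ContinuousLinearMap.proj j) ∘L
    (PiLp.continuousLinearEquiv 2 ℂ (fun _ : Fin n => H) :
      PiLp 2 (fun _ : Fin n => H) →L[ℂ] (Fin n → H))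

/-- A linear map `φ : A → B(H)` is local completely positive if there is one index `l` such that, for
all `n`, the amplification `φ⁽ⁿ⁾` sends the `l`-positive matrices to positive operators and the
`l`-null matrices to `0`. -/
def IsLocalCP (p : Λ → CStarSeminorm A) (φ : A →ₗ[ℂ] (H →L[ℂ] H)) : Prop :=
  ∃ l : Λ, ∀ (n : ℕ) (M : Matrix (Fin n) (Fin n) A),
    ((p l).MatrixNonneg n M → (blockOperator n (M.map φ)).IsPositive) ∧
    ((p l).matrixSeminorm n M = 0 → blockOperator n (M.map φ) = 0)

/-- A (unital) local representation of `A` on the Hilbert space `H`. -/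
def IsLocalRepresentation [CompleteSpace H] (p : Λ → CStarSeminorm A)
    (π : A →⋆ₐ[ℂ] (H →L[ℂ] H)) : Prop :=
  ∃ l : Λ, ∀ a : A, ‖π a‖ ≤ p l a

/-- `π` is irreducible: the commutant of `π(A)` in `B(H)` is `ℂ 1`. -/
def IsIrreducibleRepresentation [CompleteSpace H] (π : A →⋆ₐ[ℂ] (H →L[ℂ] H)) : Prop :=
  ∀ T : H →L[ℂ] H, (∀ a, T * π a = π a * T) ↔ ∃ z : ℂ, T = z • (1 : H →L[ℂ] H)

/-- `π : A → B(H)` is a local boundary representation for `S`: it is an irreducible local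
representation, and it is the unique local completely positive extension of `π|_S` to `A`. -/
structure IsLocalBoundaryRepresentation [CompleteSpace H] (p : Λ → CStarSeminorm A)
    (S : LocalOperatorSystem A) (π : A →⋆ₐ[ℂ] (H →L[ℂ] H)) : Prop where
  isLocalRepresentation : IsLocalRepresentation p π
  irreducible : IsIrreducibleRepresentation π
  isLocalCP : IsLocalCP p (π.toAlgHom.toLinearMap)
  unique : ∀ φ : A →ₗ[ℂ] (H →L[ℂ] H), IsLocalCP p φ → (∀ s ∈ S.carrier, φ s = π s) →
    φ = π.toAlgHom.toLinearMap

/-- A linear map `Φ : S₁ → S₂` is local completely isometric with respect to the families `p` and `q`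
(with the same index set): every amplification of `Φ` preserves every seminorm. -/
def IsLocalCompletelyIsometric {B : Type*} [Ring B] [StarRing B] [Algebra ℂ B] [StarModule ℂ B]
    (p : Λ → CStarSeminorm A) (q : Λ → CStarSeminorm B)
    (S₁ : LocalOperatorSystem A) (S₂ : LocalOperatorSystem B)
    (Φ : S₁.toSubmodule →ₗ[ℂ] S₂.toSubmodule) : Prop :=
  ∀ (l : Λ) (n : ℕ) (M : Matrix (Fin n) (Fin n) S₁.toSubmodule),
    (q l).matrixSeminorm n (M.map fun s => (Φ s : B)) =
      (p l).matrixSeminorm n (M.map fun s => (s : A))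

end Maps

/-! The argument is the one for C⋆-algebras, carried out for one seminorm at a time. It rests on two
facts.

Dilation (`CStarSeminorm.exists_dilation`): a unital map on a subspace containing the unit that is
completely positive with respect to `p` has the form `V⋆ σ(·) V`, with `σ` a `p`-contractive
representation and `V` an isometry. Arveson extension and Stinespring dilation are obtained
together: the map is a positive functional on kernels, M. Riesz extends it, and a GNS construction
represents the extension. Positivity is expressed by real parts (`a + a⋆ ≥ 0`), which a unital
complete isometry preserves because they can be read off the norms `‖a - t‖`
(`IsLocalCompletelyIsometric.nonneg_iff`).

Rigidity (`IsLocalBoundaryRepresentation.apply_isometry_eq`): if `σ` on `A₂` and an isometry `V`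
satisfy `V⋆ σ(Φ s) V = π₁ s`, then `σ(Φ s) V = V π₁(s)`. Indeed `σ ∘ Φ` dilates to a representation
`τ` of `A₁` along an isometry `W`. The compression of `τ` by `W V` is local CP and extends `π₁` from
`S₁`, so it equals `π₁`. A compression to a representation is an intertwining, and applying `W⋆`
gives the claim.

Now dilate `π₁ ∘ Φ⁻¹` to `σ` on `A₂`. By rigidity and generation the range of `V` is invariant under
`σ(A₂)`, and `π₂` is the restriction. It is irreducible because `π₂(S₂) = π₁(S₁)` and `S₁` generates
`A₁`. A local CP map `φ` agreeing with `π₂` on `S₂` also has a dilation; rigidity makes `φ` a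
representation, and representations agreeing on `S₂` coincide. Dilating `φ` requires positivity in
`M_n(A_l)` to imply `≥_l 0` in `M_n(A)`, which is `IsLocallyCStarAlgebra.matrixNonneg_of_nonneg`. -/

open scoped ComplexOrder InnerProductSpace Topology

/-! ### Cones of operator-valued kernels and extension of positive functionals. -/

section Kernels

variable {X B : Type*} [CStarAlgebra B]

/-- The rank one kernel `(x, y) ↦ u(x)⋆ v(y)` attached to two finitely supported functions. -/
noncomputable def gramKernel (u v : X →₀ B) : X × X →₀ B :=
  Finsupp.onFinset (u.support ×ˢ v.support) (fun z => star (u z.1) * v z.2) fun z hz => by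
    rw [Finset.mem_product, Finsupp.mem_support_iff, Finsupp.mem_support_iff]
    refine ⟨fun h => hz ?_, fun h => hz ?_⟩ <;> simp [h]

@[simp]
theorem gramKernel_apply (u v : X →₀ B) (z : X × X) :
    gramKernel u v z = star (u z.1) * v z.2 := rfl

theorem gramKernel_add_left (u u' v : X →₀ B) :
    gramKernel (u + u') v = gramKernel u v + gramKernel u' v := by
  ext z; simp [add_mul]

theorem gramKernel_add_right (u v v' : X →₀ B) :
    gramKernel u (v + v') = gramKernel u v + gramKernel u v' := by
  ext z; simp [mul_add]

theorem gramKernel_smul_right (c : ℂ) (u v : X →₀ B) :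
    gramKernel u (c • v) = c • gramKernel u v := by
  ext z; simp

theorem gramKernel_single (x y : X) (a b : B) :
    gramKernel (Finsupp.single x a) (Finsupp.single y b) =
      Finsupp.single (x, y) (star a * b) := by
  classical
  ext ⟨s, t⟩
  simp only [gramKernel_apply, Finsupp.single_apply, Prod.mk.injEq]
  by_cases hs : x = s <;> by_cases ht : y = t <;> simp [hs, ht]

theorem star_single_swap_apply (x y : X) (b : B) (z : X × X) :
    star (Finsupp.single (x, y) b z.swap) = Finsupp.single (y, x) (star b) z := by
  classical
  obtain ⟨s, t⟩ := z
  simp only [Finsupp.single_apply, Prod.swap_prod_mk, Prod.mk.injEq, and_comm (a := x = t)]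
  split_ifs <;> simp

/-- The kernels which are sums of kernels `u⋆ u`. -/
noncomputable def sumSquaresKernels (X B : Type*) [CStarAlgebra B] : PointedCone ℝ (X × X →₀ B) :=
  Submodule.span {c : ℝ // 0 ≤ c} (Set.range fun u : X →₀ B => gramKernel u u)

theorem gramKernel_mem_sumSquaresKernels (u : X →₀ B) :
    gramKernel u u ∈ sumSquaresKernels X B :=
  Submodule.subset_span ⟨u, rfl⟩

/-- The kernels whose hermitian part is a sum of kernels `u⋆ u`. -/
noncomputable def accretiveKernels (X B : Type*) [CStarAlgebra B] :
    PointedCone ℝ (X × X →₀ B) where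
  carrier := {M | ∃ P ∈ sumSquaresKernels X B, ∀ z, M z + star (M z.swap) = P z}
  zero_mem' := ⟨0, zero_mem _, by simp⟩
  add_mem' := by
    rintro M N ⟨P, hP, hMP⟩ ⟨Q, hQ, hNQ⟩
    refine ⟨P + Q, add_mem hP hQ, fun z => ?_⟩
    rw [Finsupp.add_apply, Finsupp.add_apply, Finsupp.add_apply, ← hMP, ← hNQ, star_add]
    abel
  smul_mem' := by
    rintro c M ⟨P, hP, hMP⟩
    refine ⟨c • P, Submodule.smul_mem _ c hP, fun z => ?_⟩
    change (c : ℝ) • M z + star ((c : ℝ) • M z.swap) = (c : ℝ) • P z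
    rw [← hMP, star_smul, smul_add, star_trivial]

theorem mem_accretiveKernels {M : X × X →₀ B} :
    M ∈ accretiveKernels X B ↔ ∃ P ∈ sumSquaresKernels X B, ∀ z, M z + star (M z.swap) = P z :=
  Iff.rfl

/-- The cone contains the whole space of skew kernels, so a functional nonnegative on it vanishes
there. This is how hermitian symmetry of the extended functional arises. -/
theorem mem_accretiveKernels_of_skew {M : X × X →₀ B} (h : ∀ z, M z + star (M z.swap) = 0) :
    M ∈ accretiveKernels X B :=
  ⟨0, zero_mem _, h⟩

theorem gramKernel_mem_accretiveKernels (u : X →₀ B) :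
    gramKernel u u ∈ accretiveKernels X B :=
  ⟨gramKernel u u + gramKernel u u,
    add_mem (gramKernel_mem_sumSquaresKernels u) (gramKernel_mem_sumSquaresKernels u),
    fun z => by simp⟩

variable [PartialOrder B] [StarOrderedRing B]

/-- Turns `b⋆ b ≤ ‖b‖²` into an identity between squares, which can be inserted into kernels and
inner products. -/
theorem exists_star_mul_self_eq_norm_sq_sub (b : B) :
    ∃ c : B, star c * c = (‖b‖ ^ 2 : ℝ) • (1 : B) - star b * b := by
  have h : 0 ≤ (‖b‖ ^ 2 : ℝ) • (1 : B) - star b * b := by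
    rw [sub_nonneg, ← Algebra.algebraMap_eq_smul_one, sq, ← CStarRing.norm_star_mul_self]
    exact (IsSelfAdjoint.star_mul_self b).le_algebraMap_norm_self
  obtain ⟨c, hc⟩ := CStarAlgebra.nonneg_iff_eq_star_mul_self.mp h
  exact ⟨c, hc.symm⟩

/-- Scalar diagonal kernels are order units for the cone of accretive kernels. -/
theorem exists_add_mem_accretiveKernels (T : Submodule ℂ B) (h1 : (1 : B) ∈ T)
    (M : X × X →₀ B) :
    ∃ N : X × X →₀ B, (∀ z, N z ∈ T) ∧ N + M ∈ accretiveKernels X B := by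
  classical
  induction M using Finsupp.induction_linear with
  | zero => exact ⟨0, fun z => zero_mem T, by simp⟩
  | add M M' h h' =>
    obtain ⟨N, hN, hM⟩ := h
    obtain ⟨N', hN', hM'⟩ := h'
    refine ⟨N + N', fun z => add_mem (hN z) (hN' z), ?_⟩
    rw [add_add_add_comm]
    exact add_mem hM hM'
  | single z b =>
    obtain ⟨x, y⟩ := z
    obtain ⟨c, hc⟩ := exists_star_mul_self_eq_norm_sq_sub b
    -- The kernel `u⋆u + v⋆v` is `b` at `(x, y)`, `b⋆` at `(y, x)`, `1` at `(x, x)` and `b⋆b + c⋆c =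
    -- ‖b‖²` at `(y, y)`. The factors `1/2` below compensate for the doubling of the diagonal in `N
    -- + N⋆`.
    set u : X →₀ B := Finsupp.single x 1 + Finsupp.single y b
    set v : X →₀ B := Finsupp.single y c
    refine ⟨Finsupp.single (x, x) ((1 / 2 : ℝ) • (1 : B)) +
      Finsupp.single (y, y) ((1 / 2 * ‖b‖ ^ 2 : ℝ) • (1 : B)), fun z => ?_,
      gramKernel u u + gramKernel v v, add_mem (gramKernel_mem_sumSquaresKernels u)
        (gramKernel_mem_sumSquaresKernels v), fun z => ?_⟩
    · have hT (r : ℝ) : r • (1 : B) ∈ T := by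
        rw [← Complex.coe_smul]; exact T.smul_mem _ h1
      rw [Finsupp.add_apply, Finsupp.single_apply, Finsupp.single_apply]
      refine add_mem ?_ ?_ <;> split_ifs <;> first | exact hT _ | exact zero_mem T
    · have hc' : star c * c + star b * b = (‖b‖ ^ 2 : ℝ) • (1 : B) := by rw [hc]; abel
      have e1 : (1 / 2 : ℝ) • (1 : B) + (1 / 2 : ℝ) • (1 : B) = 1 := by
        rw [← add_smul]; norm_num
      have e2 : (1 / 2 * ‖b‖ ^ 2 : ℝ) • (1 : B) + (1 / 2 * ‖b‖ ^ 2 : ℝ) • (1 : B) =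
          star c * c + star b * b := by
        rw [← add_smul, hc']; ring_nf
      simp only [u, v, gramKernel_add_left, gramKernel_add_right, gramKernel_single,
        Finsupp.add_apply, star_add, star_single_swap_apply, star_smul, star_one, star_trivial,
        one_mul, mul_one]
      generalize (1 / 2 : ℝ) • (1 : B) = p at e1 ⊢
      generalize (1 / 2 * ‖b‖ ^ 2 : ℝ) • (1 : B) = q at e2 ⊢
      rw [← e1, Finsupp.single_add, eq_sub_of_add_eq e2.symm, Finsupp.single_sub,
        Finsupp.single_add, Finsupp.sub_apply, Finsupp.add_apply, Finsupp.add_apply]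
      abel

/-- A hermitian positive functional on the finitely supported `B`-valued kernels. -/
structure PositiveKernelFunctional (X B : Type*) [CStarAlgebra B] extends
    (X × X →₀ B) →ₗ[ℂ] ℂ where
  conj_apply : ∀ u v : X →₀ B, (starRingEnd ℂ) (toLinearMap (gramKernel v u)) =
    toLinearMap (gramKernel u v)
  nonneg : ∀ u : X →₀ B, 0 ≤ (toLinearMap (gramKernel u u)).re

/-- Extension of positive functionals from the kernels with values in an operator system. -/
theorem exists_positiveKernelFunctional (T : Submodule ℂ B) (h1 : (1 : B) ∈ T)
    (f : (X × X →₀ B) →ₗ[ℂ] ℂ)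
    (hf : ∀ M ∈ accretiveKernels X B, (∀ z, M z ∈ T) → 0 ≤ (f M).re) :
    ∃ g : PositiveKernelFunctional X B, ∀ M, (∀ z, M z ∈ T) → g.toLinearMap M = f M := by
  let D : Submodule ℝ (X × X →₀ B) :=
    { carrier := {M | ∀ z, M z ∈ T}
      zero_mem' := fun z => zero_mem T
      add_mem' := fun hM hN z => add_mem (hM z) (hN z)
      smul_mem' := fun c M hM z => by
        rw [Finsupp.smul_apply, ← Complex.coe_smul]; exact T.smul_mem _ (hM z) }
  let fr : (X × X →₀ B) →ₗ[ℝ] ℝ := Complex.reLm ∘ₗ f.restrictScalars ℝ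
  -- The extension is made for the real part, on all kernels as a real space; the complex functional
  -- is recovered from it afterwards.
  obtain ⟨g, hgf, hg⟩ := riesz_extension (accretiveKernels X B) ⟨D, fr.domRestrict D⟩
    (fun M hM => hf M hM M.2) (fun M => by
      obtain ⟨N, hN, hNM⟩ := exists_add_mem_accretiveKernels T h1 M
      exact ⟨⟨N, hN⟩, hNM⟩)
  have hskew (M : X × X →₀ B) (hM : ∀ z, M z + star (M z.swap) = 0) : g M = 0 := by
    refine le_antisymm ?_ (hg M (mem_accretiveKernels_of_skew hM))
    have := hg (-M) (mem_accretiveKernels_of_skew fun z => by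
      have := congrArg Neg.neg (hM z)
      simpa [add_comm] using this)
    rw [map_neg] at this
    linarith
  have hre (M) : (Module.Dual.extendRCLike (𝕜 := ℂ) g M).re = g M := by
    simp [Module.Dual.extendRCLike_apply]
  have him (M) : (Module.Dual.extendRCLike (𝕜 := ℂ) g M).im = - g (Complex.I • M) := by
    simp [Module.Dual.extendRCLike_apply]
  refine ⟨⟨Module.Dual.extendRCLike g, fun u v => ?_, fun u => ?_⟩, fun M hM => ?_⟩
  -- The two skew kernels give the real and the imaginary part of the symmetry.
  · have h1 := hskew (gramKernel v u - gramKernel u v) fun z => by simp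
    have h2 := hskew (Complex.I • (gramKernel v u + gramKernel u v)) fun z => by
      simp only [Finsupp.smul_apply, Finsupp.add_apply, gramKernel_apply, Prod.fst_swap,
        Prod.snd_swap, star_smul, star_add, star_mul, star_star, smul_add, Complex.star_def,
        Complex.conj_I, neg_smul]
      abel
    rw [map_sub] at h1
    rw [smul_add, map_add] at h2
    apply Complex.ext
    · rw [Complex.conj_re, hre, hre]; linarith
    · rw [Complex.conj_im, him, him]; linarith
  · rw [hre]
    exact hg _ (gramKernel_mem_accretiveKernels u)
  · have h1 : g M = (f M).re := hgf ⟨M, hM⟩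
    have h2 : g (Complex.I • M) = (f (Complex.I • M)).re :=
      hgf ⟨Complex.I • M, fun z => T.smul_mem _ (hM z)⟩
    apply Complex.ext
    · rw [hre, h1]
    · rw [him, h2, map_smul]
      simp

end Kernels

/-! ### The GNS representation of a positive functional on kernels. -/

namespace PositiveKernelFunctional

open UniformSpace Completion

variable {X B : Type*} [CStarAlgebra B] (f : PositiveKernelFunctional X B)

/-- The space of finitely supported `B`-valued functions on `X`, with the inner product given by
the positive functional `f`. -/
def PreGNS (_ : PositiveKernelFunctional X B) : Type _ := X →₀ B

noncomputable instance : AddCommGroup f.PreGNS := inferInstanceAs (AddCommGroup (X →₀ B))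

noncomputable instance : Module ℂ f.PreGNS := inferInstanceAs (Module ℂ (X →₀ B))

/-- The identification of finitely supported functions with elements of the pre-Hilbert space. -/
noncomputable def toPreGNS : (X →₀ B) ≃ₗ[ℂ] f.PreGNS := LinearEquiv.refl ℂ _

noncomputable abbrev preInnerProductSpaceCore : PreInnerProductSpace.Core ℂ f.PreGNS where
  inner u v := f.toLinearMap (gramKernel (f.toPreGNS.symm u) (f.toPreGNS.symm v))
  conj_inner_symm u v := f.conj_apply _ _
  re_inner_nonneg u := f.nonneg _
  add_left u v w := by rw [map_add, gramKernel_add_left, map_add]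
  smul_left u v c := by
    rw [← f.conj_apply, map_smul, gramKernel_smul_right, map_smul, smul_eq_mul, map_mul,
      f.conj_apply]

noncomputable instance : SeminormedAddCommGroup f.PreGNS :=
  InnerProductSpace.Core.toSeminormedAddCommGroup (c := f.preInnerProductSpaceCore)

noncomputable instance : InnerProductSpace ℂ f.PreGNS :=
  InnerProductSpace.ofCore f.preInnerProductSpaceCore

theorem inner_toPreGNS (u v : X →₀ B) :
    ⟪f.toPreGNS u, f.toPreGNS v⟫_ℂ = f.toLinearMap (gramKernel u v) := rfl

/-- The Hilbert space attached to a positive functional on kernels. -/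
abbrev GNS := UniformSpace.Completion f.PreGNS

theorem norm_toPreGNS_sq (u : X →₀ B) :
    ‖f.toPreGNS u‖ ^ 2 = (f.toLinearMap (gramKernel u u)).re := by
  rw [← inner_toPreGNS, ← inner_self_eq_norm_sq (𝕜 := ℂ)]
  rfl

theorem exists_toPreGNS_eq (z : f.PreGNS) : ∃ u, f.toPreGNS u = z := f.toPreGNS.surjective z

variable [PartialOrder B] [StarOrderedRing B]

/-- With `c⋆c = ‖b‖² - b⋆b`, one has `‖c u‖² + ‖b u‖² = ‖b‖² ‖u‖²`. -/
theorem norm_toPreGNS_smul_le (b : B) (u : X →₀ B) :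
    ‖f.toPreGNS (b • u)‖ ≤ ‖b‖ * ‖f.toPreGNS u‖ := by
  obtain ⟨c, hc⟩ := exists_star_mul_self_eq_norm_sq_sub b
  have h : gramKernel (c • u) (c • u) + gramKernel (b • u) (b • u) =
      ((‖b‖ ^ 2 : ℝ) : ℂ) • gramKernel u u := by
    ext z
    have : star (u z.1) * (star c * c) * u z.2 + star (u z.1) * (star b * b) * u z.2 =
        ((‖b‖ ^ 2 : ℝ) : ℂ) • (star (u z.1) * u z.2) := by
      rw [hc, Complex.coe_smul]; simp [mul_sub, sub_mul]
    simpa [mul_assoc] using this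
  have h2 := congrArg (fun M => (f.toLinearMap M).re) h
  simp only [map_add, map_smul, Complex.add_re, smul_eq_mul, Complex.re_ofReal_mul,
    ← norm_toPreGNS_sq] at h2
  rw [← sq_le_sq₀ (by positivity) (by positivity), mul_pow, ← h2]
  nlinarith [sq_nonneg ‖f.toPreGNS (c • u)‖]

/-- Left multiplication on the pre-Hilbert space. -/
noncomputable def leftMulPreGNS (b : B) : f.PreGNS →L[ℂ] f.PreGNS :=
  (f.toPreGNS.toLinearMap ∘ₗ Algebra.lsmul ℂ ℂ (X →₀ B) b ∘ₗ
    f.toPreGNS.symm.toLinearMap).mkContinuous ‖b‖ fun u =>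
      f.norm_toPreGNS_smul_le b (f.toPreGNS.symm u)

theorem leftMulPreGNS_apply (b : B) (u : X →₀ B) :
    f.leftMulPreGNS b (f.toPreGNS u) = f.toPreGNS (b • u) := rfl

/-- The representation on the Hilbert space attached to a positive functional on kernels. -/
noncomputable def gnsStarAlgHom : B →⋆ₐ[ℂ] (f.GNS →L[ℂ] f.GNS) where
  toFun b := (f.leftMulPreGNS b).completion
  map_one' := by
    ext c
    induction c using induction_on with
    | hp => apply isClosed_eq <;> fun_prop
    | ih c =>
      obtain ⟨u, rfl⟩ := f.exists_toPreGNS_eq c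
      simp [leftMulPreGNS_apply]
  map_mul' a b := by
    ext c
    induction c using induction_on with
    | hp => apply isClosed_eq <;> fun_prop
    | ih c =>
      obtain ⟨u, rfl⟩ := f.exists_toPreGNS_eq c
      simp [leftMulPreGNS_apply, mul_smul]
  map_zero' := by
    ext c
    induction c using induction_on with
    | hp => apply isClosed_eq <;> fun_prop
    | ih c =>
      obtain ⟨u, rfl⟩ := f.exists_toPreGNS_eq c
      simp [leftMulPreGNS_apply, Completion.coe_zero]
  map_add' a b := by
    ext c
    induction c using induction_on with
    | hp => apply isClosed_eq <;> fun_prop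
    | ih c =>
      obtain ⟨u, rfl⟩ := f.exists_toPreGNS_eq c
      simp [leftMulPreGNS_apply, add_smul, Completion.coe_add]
  commutes' r := by
    ext c
    induction c using induction_on with
    | hp => apply isClosed_eq <;> fun_prop
    | ih c =>
      obtain ⟨u, rfl⟩ := f.exists_toPreGNS_eq c
      simp [leftMulPreGNS_apply, Algebra.algebraMap_eq_smul_one, Completion.coe_smul]
  map_star' a := by
    refine (ContinuousLinearMap.eq_adjoint_iff (f.leftMulPreGNS (star a)).completion
      (f.leftMulPreGNS a).completion).mpr ?_
    intro x y
    induction x, y using induction_on₂ with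
    | hp => apply isClosed_eq <;> fun_prop
    | ih x y =>
      obtain ⟨u, rfl⟩ := f.exists_toPreGNS_eq x
      obtain ⟨v, rfl⟩ := f.exists_toPreGNS_eq y
      have : gramKernel (star a • u) v = gramKernel u (a • v) := by
        ext z; simp [mul_assoc]
      simp [leftMulPreGNS_apply, inner_toPreGNS, this]

theorem gnsStarAlgHom_apply_coe (b : B) (u : X →₀ B) :
    f.gnsStarAlgHom b (f.toPreGNS u : f.GNS) = (f.toPreGNS (b • u) : f.GNS) := by
  change (f.leftMulPreGNS b).completion _ = _
  simp [leftMulPreGNS_apply]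

end PositiveKernelFunctional

/-! ### Dilation of completely positive maps on operator systems in a C⋆-algebra. -/

section Dilation

variable {B H : Type*} [CStarAlgebra B] [NormedAddCommGroup H] [InnerProductSpace ℂ H]

/-- The functional on kernels attached to a linear map into `B(H)`. -/
noncomputable def kernelFunctional (φ : B →ₗ[ℂ] (H →L[ℂ] H)) : (H × H →₀ B) →ₗ[ℂ] ℂ :=
  Finsupp.lsum ℂ fun z => (innerSL ℂ z.1).toLinearMap ∘ₗ
    (ContinuousLinearMap.apply ℂ H z.2).toLinearMap ∘ₗ φ

theorem kernelFunctional_single (φ : B →ₗ[ℂ] (H →L[ℂ] H)) (z : H × H) (b : B) :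
    kernelFunctional φ (Finsupp.single z b) = ⟪z.1, φ b z.2⟫_ℂ := by
  simp [kernelFunctional]

/-- Both coordinates of the support are enumerated by one finite set, so that the kernel becomes a
square matrix and matrix positivity applies. -/
theorem kernelFunctional_eq_sum (φ : B →ₗ[ℂ] (H →L[ℂ] H)) (M : H × H →₀ B) :
    ∃ (n : ℕ) (x : Fin n → H), kernelFunctional φ M =
      ∑ i, ∑ j, ⟪x i, φ (M (x i, x j)) (x j)⟫_ℂ := by
  classical
  let F : Finset H := M.support.image Prod.fst ∪ M.support.image Prod.snd
  refine ⟨F.card, fun i => F.equivFin.symm i, ?_⟩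
  have h1 : kernelFunctional φ M = ∑ z ∈ F ×ˢ F, ⟪z.1, φ (M z) z.2⟫_ℂ := by
    rw [kernelFunctional, Finsupp.lsum_apply, Finsupp.sum]
    refine Finset.sum_subset (fun z hz => ?_) fun z _ hz => ?_
    · rw [Finset.mem_product]
      exact ⟨Finset.mem_union_left _ (Finset.mem_image_of_mem _ hz),
        Finset.mem_union_right _ (Finset.mem_image_of_mem _ hz)⟩
    · simp [Finsupp.notMem_support_iff.mp hz]
  have h2 (g : H → ℂ) : ∑ x ∈ F, g x = ∑ i : Fin F.card, g (F.equivFin.symm i) := by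
    rw [← Finset.sum_coe_sort F g]
    exact (F.equivFin.symm.sum_comp fun x : F => g x).symm
  rw [h1, Finset.sum_product, h2]
  exact Finset.sum_congr rfl fun i _ => h2 _

/-- An isometry between inner product spaces from a map preserving inner products. -/
theorem exists_linearIsometry_of_inner {K : Type*} [NormedAddCommGroup K] [InnerProductSpace ℂ K]
    (V : H → K) (hV : ∀ x y, ⟪V x, V y⟫_ℂ = ⟪x, y⟫_ℂ) :
    ∃ W : H →ₗᵢ[ℂ] K, ∀ x, W x = V x := by
  refine ⟨LinearMap.isometryOfInner
    { toFun := V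
      map_add' := fun x y => ?_
      map_smul' := fun c x => ?_ } hV, fun x => rfl⟩
  · rw [← sub_eq_zero, ← inner_self_eq_zero (𝕜 := ℂ)]
    simp only [inner_sub_left, inner_sub_right, inner_add_left, inner_add_right, hV]
    ring
  · rw [RingHom.id_apply, ← sub_eq_zero, ← inner_self_eq_zero (𝕜 := ℂ)]
    simp only [inner_sub_left, inner_sub_right, inner_smul_left, inner_smul_right, hV]
    ring

variable {X : Type*} [PartialOrder B] [StarOrderedRing B]

/-- The matrix is `U⋆ U`, where `U` has the values of `u` in its first row and zeros elsewhere. Size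
`0` has no such row and is treated separately. -/
theorem ofMatrix_gramKernel_nonneg (u : X →₀ B) {n : ℕ} (x : Fin n → X) :
    0 ≤ CStarMatrix.ofMatrix (Matrix.of fun i j => gramKernel u u (x i, x j)) := by
  rcases n with _ | n
  · exact le_of_eq (CStarMatrix.ext fun i => i.elim0)
  · let U : CStarMatrix (Fin (n + 1)) (Fin (n + 1)) B :=
      CStarMatrix.ofMatrix (Matrix.of fun k j => if k = 0 then u (x j) else 0)
    have : CStarMatrix.ofMatrix (Matrix.of fun i j => gramKernel u u (x i, x j)) =
        star U * U := by
      ext i j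
      rw [CStarMatrix.mul_apply, Finset.sum_eq_single 0]
      · simp [U, CStarMatrix.star_apply]
      · intro k _ hk
        simp [U, hk]
      · simp
    rw [this]
    exact star_mul_self_nonneg U

theorem ofMatrix_nonneg_of_mem_sumSquaresKernels {P : X × X →₀ B}
    (hP : P ∈ sumSquaresKernels X B) {n : ℕ} (x : Fin n → X) :
    0 ≤ CStarMatrix.ofMatrix (Matrix.of fun i j => P (x i, x j)) := by
  induction hP using Submodule.span_induction with
  | mem P hP =>
    obtain ⟨u, rfl⟩ := hP
    exact ofMatrix_gramKernel_nonneg u x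
  | zero => exact le_rfl
  | add P Q _ _ hP hQ => exact add_nonneg hP hQ
  | smul c P _ hP => exact smul_nonneg c.2 hP

universe u v

/-- Dilation theorem: a unital completely positive map on an operator system `T` (here given by a
linear map `φ` of which only the values on `T` matter) is the compression of a representation. -/
theorem exists_dilation {B : Type u} [CStarAlgebra B] [PartialOrder B] [StarOrderedRing B]
    {H : Type v} [NormedAddCommGroup H] [InnerProductSpace ℂ H]
    (T : Submodule ℂ B) (h1 : (1 : B) ∈ T) (φ : B →ₗ[ℂ] (H →L[ℂ] H)) (hφ : φ 1 = 1)
    (hpos : ∀ (n : ℕ) (M : CStarMatrix (Fin n) (Fin n) B), (∀ i j, M i j ∈ T) →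
      0 ≤ M + star M → ∀ x : Fin n → H, 0 ≤ (∑ i, ∑ j, ⟪x i, φ (M i j) (x j)⟫_ℂ).re) :
    ∃ (K : Type max u v) (_ : NormedAddCommGroup K) (_ : InnerProductSpace ℂ K)
      (_ : CompleteSpace K) (σ : B →⋆ₐ[ℂ] (K →L[ℂ] K)) (V : H →ₗᵢ[ℂ] K),
      ∀ t ∈ T, ∀ x y, ⟪V x, σ t (V y)⟫_ℂ = ⟪x, φ t y⟫_ℂ := by
  obtain ⟨g, hg⟩ := exists_positiveKernelFunctional T h1 (kernelFunctional φ) fun M hM hMT => by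
    obtain ⟨n, x, hx⟩ := kernelFunctional_eq_sum φ M
    obtain ⟨P, hP, hMP⟩ := mem_accretiveKernels.mp hM
    rw [hx]
    refine hpos n (CStarMatrix.ofMatrix (Matrix.of fun i j => M (x i, x j)))
      (fun i j => hMT _) ?_ x
    convert ofMatrix_nonneg_of_mem_sumSquaresKernels hP x using 1
    ext i j
    exact hMP (x i, x j)
  have key (t : B) (ht : t ∈ T) (x y : H) : ⟪((g.toPreGNS (Finsupp.single x 1) : g.PreGNS) : g.GNS),
      g.gnsStarAlgHom t (g.toPreGNS (Finsupp.single y 1) : g.PreGNS)⟫_ℂ = ⟪x, φ t y⟫_ℂ := by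
    rw [g.gnsStarAlgHom_apply_coe, UniformSpace.Completion.inner_coe, g.inner_toPreGNS,
      Finsupp.smul_single, smul_eq_mul, gramKernel_single, hg, kernelFunctional_single]
    · simp
    · classical
      intro z
      rw [Finsupp.single_apply]
      split_ifs
      · simpa using ht
      · exact zero_mem T
  -- The map `x ↦ δ_x` into finitely supported functions is not linear; it becomes linear in the
  -- Hilbert space because `φ 1 = 1` makes it preserve inner products.
  obtain ⟨V, hV⟩ := exists_linearIsometry_of_inner
    (fun x : H => ((g.toPreGNS (Finsupp.single x 1) : g.PreGNS) : g.GNS)) fun x y => by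
      simpa [hφ] using key 1 h1 x y
  exact ⟨g.GNS, inferInstance, inferInstance, inferInstance, g.gnsStarAlgHom, V,
    fun t ht x y => by rw [hV, hV]; exact key t ht x y⟩

end Dilation

/-! ### Positivity of the real part in terms of the norm. -/

section OrderAndNorm

variable {D : Type*} [CStarAlgebra D] [PartialOrder D] [StarOrderedRing D]

/-- In `(a - t)⋆(a - t) = a⋆a - t(a + a⋆) + t²` the middle term only decreases the right side. -/
theorem norm_sub_smul_one_sq_le {a : D} (ha : 0 ≤ a + star a) {t : ℝ} (ht : 0 ≤ t) :
    ‖a - (t : ℂ) • (1 : D)‖ ^ 2 ≤ t ^ 2 + ‖a‖ ^ 2 := by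
  have h1 : star (a - (t : ℂ) • (1 : D)) * (a - (t : ℂ) • (1 : D)) =
      star a * a - t • (a + star a) + algebraMap ℝ D (t ^ 2) := by
    rw [Algebra.algebraMap_eq_smul_one, Complex.coe_smul, star_sub, star_smul, star_one,
      star_trivial t, sub_mul, mul_sub, mul_sub, smul_mul_assoc, smul_mul_assoc, one_mul, one_mul,
      mul_smul_comm, mul_one, smul_smul, smul_add, sq]
    abel
  have h2 : star (a - (t : ℂ) • (1 : D)) * (a - (t : ℂ) • (1 : D)) ≤
      algebraMap ℝ D (t ^ 2 + ‖a‖ ^ 2) := by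
    have h3 : star a * a ≤ algebraMap ℝ D (‖a‖ ^ 2) := by
      rw [sq, ← CStarRing.norm_star_mul_self]
      exact (IsSelfAdjoint.star_mul_self a).le_algebraMap_norm_self
    rw [h1, map_add, add_comm (algebraMap ℝ D (t ^ 2))]
    exact add_le_add_left ((sub_le_self _ (smul_nonneg ht ha)).trans h3) _
  rw [sq, ← CStarRing.norm_star_mul_self]
  exact (CStarAlgebra.norm_le_iff_le_algebraMap _ (by positivity) (star_mul_self_nonneg _)).mpr h2

/-- The bound gives `‖a - t‖ ≤ t + c/(2t)`, hence `2t - (a + a⋆) ≤ 2t + c/t`, that is `a + a⋆ ≥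
-c/t`. Let `t → ∞`. -/
theorem add_star_nonneg_of_norm_sub_smul_one_sq_le {a : D} {c : ℝ} (hc : 0 ≤ c)
    (h : ∀ t : ℝ, 0 ≤ t → ‖a - (t : ℂ) • (1 : D)‖ ^ 2 ≤ t ^ 2 + c) : 0 ≤ a + star a := by
  have hsa : IsSelfAdjoint (a + star a) := IsSelfAdjoint.add_star_self a
  have key (t : ℝ) (ht : 0 < t) : algebraMap ℝ D (-(c / t)) ≤ a + star a := by
    have h1 : ‖algebraMap ℝ D (2 * t) - (a + star a)‖ ≤ 2 * t + c / t := by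
      have e : algebraMap ℝ D (2 * t) - (a + star a) =
          -((a - (t : ℂ) • (1 : D)) + star (a - (t : ℂ) • (1 : D))) := by
        rw [Algebra.algebraMap_eq_smul_one, Complex.coe_smul, star_sub, star_smul, star_one,
          star_trivial t, two_mul, add_smul]
        abel
      have h2 : ‖a - (t : ℂ) • (1 : D)‖ ≤ t + c / (2 * t) := by
        rw [← sq_le_sq₀ (norm_nonneg _) (by positivity)]
        refine (h t ht.le).trans ?_
        have : (t + c / (2 * t)) ^ 2 = t ^ 2 + c + (c / (2 * t)) ^ 2 := by
          field_simp; ring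
        rw [this]
        nlinarith [sq_nonneg (c / (2 * t))]
      rw [e, norm_neg]
      refine (norm_add_le _ _).trans ?_
      rw [norm_star]
      have : c / t = 2 * (c / (2 * t)) := by field_simp
      linarith
    have h2 : algebraMap ℝ D (2 * t) - (a + star a) ≤ algebraMap ℝ D (2 * t + c / t) :=
      (((IsSelfAdjoint.all (2 * t)).algebraMap D).sub hsa).le_algebraMap_norm_self.trans
        (algebraMap_mono D h1)
    rw [map_add, sub_le_iff_le_add, add_assoc, le_add_iff_nonneg_right] at h2
    rw [map_neg]
    exact neg_le_iff_add_nonneg'.mpr h2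
  rw [← map_zero (algebraMap ℝ D), algebraMap_le_iff_le_spectrum]
  intro x hx
  have key2 (t : ℝ) (ht : 0 < t) : -(c / t) ≤ x :=
    (algebraMap_le_iff_le_spectrum (a := a + star a)).mp (key t ht) x hx
  by_contra! hx0
  -- For this `t`, `c/t = -x · c/(c+1) < -x`, against `-(c/t) ≤ x`.
  have := key2 ((c + 1) / (-x)) (by apply div_pos <;> linarith)
  rw [div_div_eq_mul_div, neg_le, le_div_iff₀ (by linarith)] at this
  nlinarith

theorem exists_eq_star_mul_self_of_nonneg {a : D} (ha : 0 ≤ a) : ∃ b : D, a = star b * b :=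
  CStarAlgebra.nonneg_iff_eq_star_mul_self.mp ha

end OrderAndNorm

/-! ### Quadratic forms of matrices under representations. -/

section Positivity

variable {R K : Type*} [Ring R] [StarRing R] [Algebra ℂ R]
  [NormedAddCommGroup K] [InnerProductSpace ℂ K] [CompleteSpace K]

theorem sum_inner_star_mul_self (σ : R →⋆ₐ[ℂ] (K →L[ℂ] K)) {n : ℕ}
    (b : Matrix (Fin n) (Fin n) R) (x : Fin n → K) :
    ∑ i, ∑ j, ⟪x i, σ ((star b * b) i j) (x j)⟫_ℂ =
      ((∑ k, ‖∑ j, σ (b k j) (x j)‖ ^ 2 : ℝ) : ℂ) := by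
  have h (k : Fin n) : ((‖∑ j, σ (b k j) (x j)‖ ^ 2 : ℝ) : ℂ) =
      ∑ i, ∑ j, ⟪x i, σ (star (b k i) * b k j) (x j)⟫_ℂ := by
    rw [Complex.ofReal_pow, ← RCLike.ofReal_eq_complex_ofReal, ← inner_self_eq_norm_sq_to_K,
      sum_inner]
    refine Finset.sum_congr rfl fun i _ => ?_
    rw [inner_sum]
    refine Finset.sum_congr rfl fun j _ => ?_
    rw [map_mul, map_star, mul_apply_eq_comp, ContinuousLinearMap.star_eq_adjoint,
      ContinuousLinearMap.adjoint_inner_right]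
  rw [Complex.ofReal_sum, Finset.sum_congr rfl fun k _ => h k]
  refine Eq.trans (Finset.sum_congr rfl fun i _ => ?_) Finset.sum_comm
  refine Eq.trans ?_ Finset.sum_comm
  refine Finset.sum_congr rfl fun j _ => ?_
  simp only [Matrix.mul_apply, Matrix.star_apply, map_sum, sum_apply, inner_sum]

theorem sum_inner_add_star (φ : R →ₗ[ℂ] (K →L[ℂ] K)) (hφ : ∀ a, φ (star a) = star (φ a)) {n : ℕ}
    (N : Matrix (Fin n) (Fin n) R) (x : Fin n → K) :
    (∑ i, ∑ j, ⟪x i, φ ((N + star N) i j) (x j)⟫_ℂ).re =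
      2 * (∑ i, ∑ j, ⟪x i, φ (N i j) (x j)⟫_ℂ).re := by
  have h : ∑ i, ∑ j, ⟪x i, φ ((N + star N) i j) (x j)⟫_ℂ =
      ∑ i, ∑ j, ⟪x i, φ (N i j) (x j)⟫_ℂ +
        (starRingEnd ℂ) (∑ i, ∑ j, ⟪x i, φ (N i j) (x j)⟫_ℂ) := by
    rw [map_sum, Finset.sum_congr rfl fun i _ => map_sum (starRingEnd ℂ) _ _,
      Finset.sum_comm (f := fun i j => (starRingEnd ℂ) ⟪x i, φ (N i j) (x j)⟫_ℂ),
      ← Finset.sum_add_distrib]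
    refine Finset.sum_congr rfl fun i _ => ?_
    rw [← Finset.sum_add_distrib]
    refine Finset.sum_congr rfl fun j _ => ?_
    rw [Matrix.add_apply, Matrix.star_apply, map_add, add_apply, inner_add_right,
      inner_conj_symm, hφ, ContinuousLinearMap.star_eq_adjoint,
      ContinuousLinearMap.adjoint_inner_right]
  rw [h, Complex.add_re, Complex.conj_re, two_mul]

theorem re_sum_inner_nonneg {B : Type*} [CStarAlgebra B] [PartialOrder B] [StarOrderedRing B]
    (σ : B →⋆ₐ[ℂ] (K →L[ℂ] K)) {n : ℕ} {N : CStarMatrix (Fin n) (Fin n) B}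
    (hN : 0 ≤ N + star N) (x : Fin n → K) :
    0 ≤ (∑ i, ∑ j, ⟪x i, σ (N i j) (x j)⟫_ℂ).re := by
  obtain ⟨b, hb⟩ := exists_eq_star_mul_self_of_nonneg hN
  have h1 := sum_inner_add_star σ.toAlgHom.toLinearMap (map_star σ) (CStarMatrix.ofMatrix.symm N) x
  have h2 := congrArg Complex.re (sum_inner_star_mul_self σ b x)
  rw [Complex.ofReal_re] at h2
  have h3 : 0 ≤ ∑ k, ‖∑ j, σ (b k j) (x j)‖ ^ 2 := by positivity
  have h4 : CStarMatrix.ofMatrix.symm N + star (CStarMatrix.ofMatrix.symm N) = star b * b := hb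
  rw [h4] at h1
  change (∑ i, ∑ j, ⟪x i, σ ((star b * b) i j) (x j)⟫_ℂ).re =
    2 * (∑ i, ∑ j, ⟪x i, σ (N i j) (x j)⟫_ℂ).re at h1
  have h5 : (∑ i, ∑ j, ⟪x i, σ ((star b * b) i j) (x j)⟫_ℂ).re =
    ∑ k, ‖∑ j, σ (b k j) (x j)‖ ^ 2 := h2
  linarith

end Positivity

/-- Off the range of `f` the map `φ` is an arbitrary linear extension; in the uses below only its
values on the range matter. -/
theorem LinearMap.exists_comp_eq_of_ker_le {k V U W : Type*} [Field k] [AddCommGroup V]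
    [Module k V] [AddCommGroup U] [Module k U] [AddCommGroup W] [Module k W]
    (f : V →ₗ[k] U) (g : V →ₗ[k] W) (h : ∀ v, f v = 0 → g v = 0) :
    ∃ φ : U →ₗ[k] W, ∀ v, φ (f v) = g v := by
  obtain ⟨φ, hφ⟩ := LinearMap.exists_extend
    ((LinearMap.ker f).liftQ g h ∘ₗ f.quotKerEquivRange.symm.toLinearMap)
  refine ⟨φ, fun v => ?_⟩
  have := LinearMap.congr_fun hφ ⟨f v, v, rfl⟩
  have h2 : f.quotKerEquivRange.symm ⟨f v, v, rfl⟩ = (LinearMap.ker f).mkQ v := by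
    rw [LinearEquiv.symm_apply_eq]; rfl
  simp only [LinearMap.comp_apply, Submodule.subtype_apply, LinearEquiv.coe_coe, h2] at this
  exact this.trans (Submodule.liftQ_apply _ _ _)

/-! ### Passage to the C⋆-algebra of one seminorm. -/

namespace CStarSeminorm

section Morphisms

variable {A : Type*} [Ring A] [StarRing A] [Algebra ℂ A] (p : CStarSeminorm A)

theorem toQuot_one : p.toQuot 1 = 1 := rfl

variable [StarModule ℂ A]

/-- The canonical morphism `A → A_p`, as a morphism of `⋆`-algebras. -/
noncomputable def toQuotHom : A →⋆ₐ[ℂ] p.Quot where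
  toFun := p.toQuot
  map_one' := p.toQuot_one
  map_mul' := p.toQuot_mul
  map_zero' := by simpa using p.toQuot_smul 0 0
  map_add' := p.toQuot_add
  commutes' r := by
    rw [Algebra.algebraMap_eq_smul_one, Algebra.algebraMap_eq_smul_one, toQuot_smul, toQuot_one]
  map_star' := p.toQuot_star

theorem toQuotHom_apply (a : A) : p.toQuotHom a = p.toQuot a := rfl

theorem norm_toQuotHom (a : A) : ‖p.toQuotHom a‖ = p a := p.norm_toQuot a

/-- The canonical morphism `M_n(A) → M_n(A_p)`. -/
noncomputable def matrixHom (n : ℕ) :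
    Matrix (Fin n) (Fin n) A →⋆ₐ[ℂ] CStarMatrix (Fin n) (Fin n) p.Quot where
  __ := (CStarMatrix.ofMatrixStarAlgEquiv (n := Fin n) (A := p.Quot)).toAlgEquiv.toAlgHom.comp
    p.toQuotHom.toAlgHom.mapMatrix
  map_star' M := by
    ext i j
    exact p.toQuot_star (M j i)

theorem matrixHom_apply {n : ℕ} (M : Matrix (Fin n) (Fin n) A) (i j : Fin n) :
    p.matrixHom n M i j = p.toQuotHom (M i j) := rfl

theorem matrixSeminorm_eq {n : ℕ} (M : Matrix (Fin n) (Fin n) A) :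
    p.matrixSeminorm n M = ‖p.matrixHom n M‖ := rfl

theorem le_matrixSeminorm {n : ℕ} (M : Matrix (Fin n) (Fin n) A) (i j : Fin n) :
    p (M i j) ≤ p.matrixSeminorm n M := by
  rw [matrixSeminorm_eq, ← norm_toQuotHom, ← matrixHom_apply]
  exact CStarMatrix.norm_entry_le_norm

theorem eq_zero_of_matrixSeminorm_eq_zero {n : ℕ} {M : Matrix (Fin n) (Fin n) A}
    (h : p.matrixSeminorm n M = 0) (i j : Fin n) : p (M i j) = 0 :=
  le_antisymm (h ▸ p.le_matrixSeminorm M i j) (apply_nonneg p.toSeminorm _)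

theorem matrixSeminorm_one_eq_zero_iff (a : A) :
    p.matrixSeminorm 1 (Matrix.of fun _ _ => a) = 0 ↔ p a = 0 := by
  refine ⟨fun h => p.eq_zero_of_matrixSeminorm_eq_zero h 0 0, fun h => ?_⟩
  rw [matrixSeminorm_eq, norm_eq_zero]
  ext i j
  exact norm_eq_zero.mp ((p.norm_toQuotHom a).trans h)

/-- A `p`-contractive morphism factors through `A_p`. -/
theorem exists_lift_quot {K : Type*} [NormedAddCommGroup K] [InnerProductSpace ℂ K]
    [CompleteSpace K] (σ : A →⋆ₐ[ℂ] (K →L[ℂ] K)) (hσ : ∀ a, ‖σ a‖ ≤ p a) :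
    ∃ τ : p.Quot →⋆ₐ[ℂ] (K →L[ℂ] K), ∀ a, τ (p.toQuotHom a) = σ a := by
  let f : p.Space →+ (K →L[ℂ] K) := σ.toAlgHom.toLinearMap.toAddMonoidHom
  have hf : UniformContinuous f :=
    AddMonoidHomClass.uniformContinuous_of_bound f 1 fun a => by
      rw [one_mul]; exact hσ a
  let g : p.Quot → (K →L[ℂ] K) := UniformSpace.Completion.extension f
  have hg : Continuous g := UniformSpace.Completion.continuous_extension
  have hga (a : A) : g (p.toQuotHom a) = σ a := UniformSpace.Completion.extension_coe hf a
  refine ⟨{ toFun := g, map_one' := ?_, map_mul' := ?_, map_zero' := ?_, map_add' := ?_,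
            commutes' := ?_, map_star' := ?_ }, hga⟩
  · rw [← map_one p.toQuotHom, hga, map_one]
  · intro x y
    refine p.denseRange_toQuot.induction_on₂ (isClosed_eq (hg.comp continuous_mul)
      ((hg.comp continuous_fst).mul (hg.comp continuous_snd))) (fun a b => ?_) x y
    simp only [← toQuotHom_apply]
    rw [← map_mul, hga, hga, hga, map_mul]
  · rw [← map_zero p.toQuotHom, hga, map_zero]
  · intro x y
    refine p.denseRange_toQuot.induction_on₂ (isClosed_eq (hg.comp continuous_add)
      ((hg.comp continuous_fst).add (hg.comp continuous_snd))) (fun a b => ?_) x y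
    simp only [← toQuotHom_apply]
    rw [← map_add, hga, hga, hga, map_add]
  · intro r
    rw [← AlgHomClass.commutes p.toQuotHom, hga, AlgHomClass.commutes]
  · intro x
    refine p.denseRange_toQuot.induction_on x (isClosed_eq (hg.comp p.continuous_star_quot)
      (continuous_star.comp hg)) fun a => ?_
    simp only [← toQuotHom_apply]
    rw [← map_star, hga, hga, map_star]

theorem re_sum_inner_nonneg {K : Type*} [NormedAddCommGroup K] [InnerProductSpace ℂ K]
    [CompleteSpace K] (σ : A →⋆ₐ[ℂ] (K →L[ℂ] K)) (hσ : ∀ a, ‖σ a‖ ≤ p a) {n : ℕ}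
    {M : Matrix (Fin n) (Fin n) A} (hM : 0 ≤ p.matrixHom n M + star (p.matrixHom n M))
    (x : Fin n → K) : 0 ≤ (∑ i, ∑ j, ⟪x i, σ (M i j) (x j)⟫_ℂ).re := by
  obtain ⟨τ, hτ⟩ := p.exists_lift_quot σ hσ
  simpa only [matrixHom_apply, hτ] using _root_.re_sum_inner_nonneg τ hM x

end Morphisms

universe u v

/-- Dilation theorem for unital `p`-completely positive maps on a subspace containing the unit. -/
theorem exists_dilation {A : Type u} [Ring A] [StarRing A] [Algebra ℂ A] [StarModule ℂ A]
    (p : CStarSeminorm A) {H : Type v} [NormedAddCommGroup H] [InnerProductSpace ℂ H]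
    (S : Submodule ℂ A) (h1 : (1 : A) ∈ S) (ψ : S →ₗ[ℂ] (H →L[ℂ] H)) (hψ : ψ ⟨1, h1⟩ = 1)
    (hnull : ∀ s : S, p s = 0 → ψ s = 0)
    (hpos : ∀ (n : ℕ) (M : Matrix (Fin n) (Fin n) S),
      0 ≤ p.matrixHom n (M.map (↑)) + star (p.matrixHom n (M.map (↑))) →
      ∀ x : Fin n → H, 0 ≤ (∑ i, ∑ j, ⟪x i, ψ (M i j) (x j)⟫_ℂ).re) :
    ∃ (K : Type max u v) (_ : NormedAddCommGroup K) (_ : InnerProductSpace ℂ K)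
      (_ : CompleteSpace K) (σ : A →⋆ₐ[ℂ] (K →L[ℂ] K)) (V : H →ₗᵢ[ℂ] K),
      (∀ a, ‖σ a‖ ≤ p a) ∧ ∀ (s : S) (x y : H), ⟪V x, σ s (V y)⟫_ℂ = ⟪x, ψ s y⟫_ℂ := by
  let f : S →ₗ[ℂ] p.Quot := p.toQuotHom.toAlgHom.toLinearMap ∘ₗ S.subtype
  -- Since `ψ` kills `p`-null elements, it descends to the image of `S` in `A_p`.
  obtain ⟨φ, hφ⟩ := LinearMap.exists_comp_eq_of_ker_le f ψ fun s hs => hnull s <| by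
    rw [← norm_toQuotHom]
    exact norm_eq_zero.mpr hs
  have h1T : (1 : p.Quot) ∈ LinearMap.range f := ⟨⟨1, h1⟩, p.toQuot_one⟩
  obtain ⟨K, i1, i2, i3, σ, V, hV⟩ := _root_.exists_dilation (LinearMap.range f) h1T φ
    ((hφ ⟨1, h1⟩).trans hψ) fun n N hN hpN x => by
      choose M hM using hN
      have : N = p.matrixHom n (Matrix.map (Matrix.of M) (↑)) :=
        CStarMatrix.ext fun i j => (hM i j).symm
      rw [this] at hpN
      simpa only [← hM, hφ] using! hpos n (Matrix.of M) hpN x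
  refine ⟨K, i1, i2, i3, σ.comp p.toQuotHom, V, fun a => ?_, fun s x y => ?_⟩
  · rw [← norm_toQuotHom]
    exact NonUnitalStarAlgHom.norm_apply_le σ _
  · rw [← hφ]
    exact hV (f s) ⟨s, rfl⟩ x y

end CStarSeminorm

/-! ### Unital local complete isometries preserve positive real parts. -/

section CompleteIsometry

variable {A B Λ : Type*} [Ring A] [StarRing A] [Algebra ℂ A] [StarModule ℂ A]
  [Ring B] [StarRing B] [Algebra ℂ B] [StarModule ℂ B] {p : Λ → CStarSeminorm A}
  {q : Λ → CStarSeminorm B} {S₁ : LocalOperatorSystem A} {S₂ : LocalOperatorSystem B}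
  {Φ : S₁.toSubmodule →ₗ[ℂ] S₂.toSubmodule}

theorem IsLocalCompletelyIsometric.apply_eq (hΦ : IsLocalCompletelyIsometric p q S₁ S₂ Φ) (l : Λ)
    {n : ℕ} (M : Matrix (Fin n) (Fin n) S₁.toSubmodule) :
    ‖(q l).matrixHom n (M.map fun s => (Φ s : B))‖ =
      ‖(p l).matrixHom n (M.map fun s => (s : A))‖ := hΦ l n M

theorem IsLocalCompletelyIsometric.apply_eq_zero_iff
    (hΦ : IsLocalCompletelyIsometric p q S₁ S₂ Φ) (l : Λ) (s : S₁.toSubmodule) :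
    q l (Φ s) = 0 ↔ p l s = 0 := by
  rw [← CStarSeminorm.matrixSeminorm_one_eq_zero_iff,
    ← CStarSeminorm.matrixSeminorm_one_eq_zero_iff]
  have := hΦ l 1 (Matrix.of fun _ _ => s)
  exact ⟨fun h => this.symm.trans h, fun h => this.trans h⟩

/-- A unital local completely isometric map reflects and preserves positivity of real parts. -/
theorem IsLocalCompletelyIsometric.nonneg_iff (hΦ : IsLocalCompletelyIsometric p q S₁ S₂ Φ)
    (hunital : Φ S₁.unit = S₂.unit) (l : Λ) {n : ℕ}
    (M : Matrix (Fin n) (Fin n) S₁.toSubmodule) :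
    0 ≤ (q l).matrixHom n (M.map fun s => (Φ s : B)) +
        star ((q l).matrixHom n (M.map fun s => (Φ s : B))) ↔
      0 ≤ (p l).matrixHom n (M.map fun s => (s : A)) +
        star ((p l).matrixHom n (M.map fun s => (s : A))) := by
  -- Unitality enters here: `Φ` is isometric on the translates `M - t`, and their norms determine
  -- the sign of the real part.
  have key (t : ℝ) : ‖(q l).matrixHom n (M.map fun s => (Φ s : B)) - (t : ℂ) • 1‖ =
      ‖(p l).matrixHom n (M.map fun s => (s : A)) - (t : ℂ) • 1‖ := by
    have h := hΦ.apply_eq l (M - Matrix.diagonal fun _ => (t : ℂ) • S₁.unit)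
    have h1 : (M - Matrix.diagonal fun _ => (t : ℂ) • S₁.unit).map (fun s => (s : A)) =
        M.map (fun s => (s : A)) - (t : ℂ) • 1 := by
      ext i j
      rcases eq_or_ne i j with rfl | hij
      · simp [LocalOperatorSystem.unit]
      · simp [hij]
    have h2 : (M - Matrix.diagonal fun _ => (t : ℂ) • S₁.unit).map (fun s => (Φ s : B)) =
        M.map (fun s => (Φ s : B)) - (t : ℂ) • 1 := by
      ext i j
      rcases eq_or_ne i j with rfl | hij
      · simp [hunital]; simp [LocalOperatorSystem.unit]
      · simp [hij]
    rw [h1, h2, map_sub, map_sub, map_smul, map_smul, map_one, map_one] at h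
    exact h
  constructor <;> intro h
  · refine add_star_nonneg_of_norm_sub_smul_one_sq_le
      (sq_nonneg ‖(q l).matrixHom n (M.map fun s => (Φ s : B))‖) fun t ht => ?_
    rw [← key]
    exact norm_sub_smul_one_sq_le h ht
  · refine add_star_nonneg_of_norm_sub_smul_one_sq_le
      (sq_nonneg ‖(p l).matrixHom n (M.map fun s => (s : A))‖) fun t ht => ?_
    rw [key]
    exact norm_sub_smul_one_sq_le h ht

end CompleteIsometry

/-! ### Square roots in locally C⋆-algebras. -/

open Polynomial in
-- One sequence, independent of the algebra, so that the same polynomials can be used for all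
-- seminorms at once. The real `√` is `0` on negative numbers, so it is continuous on the whole
-- line.
theorem exists_polynomial_seq_near_sqrt : ∃ P : ℕ → ℝ[X],
    ∀ k : ℕ, ∀ x ∈ Set.Icc (-(k : ℝ)) k, |(P k).eval x - √x| < 1 / ((k : ℝ) + 1) := by
  have (k : ℕ) : ∃ P : ℝ[X], ∀ x ∈ Set.Icc (-(k : ℝ)) k,
      |P.eval x - √x| < 1 / ((k : ℝ) + 1) :=
    exists_polynomial_near_of_continuousOn _ _ _ Real.continuous_sqrt.continuousOn _
      Nat.one_div_pos_of_nat
  exact ⟨fun k => (this k).choose, fun k => (this k).choose_spec⟩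

open Polynomial in
/-- A sequence of polynomials which converges locally uniformly to the square root computes the
square root of every positive element of a C⋆-algebra. -/
theorem exists_tendsto_aeval_of_near_sqrt {D : Type*} [CStarAlgebra D] [PartialOrder D]
    [StarOrderedRing D] {P : ℕ → ℝ[X]}
    (hP : ∀ k : ℕ, ∀ x ∈ Set.Icc (-(k : ℝ)) k, |(P k).eval x - √x| < 1 / ((k : ℝ) + 1))
    {a : D} (ha : IsSelfAdjoint a) :
    ∃ c : D, Filter.Tendsto (fun k => aeval a ((P k).map (algebraMap ℝ ℂ))) Filter.atTop (𝓝 c) ∧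
      (0 ≤ a → star c * c = a) := by
  refine ⟨cfc Real.sqrt a, ?_, fun h => ?_⟩
  · rw [tendsto_iff_norm_sub_tendsto_zero]
    refine squeeze_zero' (Filter.Eventually.of_forall fun k => norm_nonneg _) ?_
      tendsto_one_div_add_atTop_nhds_zero_nat
    -- From this index on, the spectrum of `a` lies in `[-k, k]`.
    filter_upwards [Filter.eventually_ge_atTop ⌈‖a‖⌉₊] with k hk
    rw [aeval_map_algebraMap, ← cfc_polynomial (P k) a, ← cfc_sub _ _ a]
    refine norm_cfc_le Nat.one_div_pos_of_nat.le fun x hx => ?_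
    rw [Real.norm_eq_abs]
    refine (hP k x ?_).le
    have h1 : |x| ≤ ‖a‖ := by
      rcases subsingleton_or_nontrivial D with hD | hD
      · simp [spectrum.of_subsingleton] at hx
      · exact spectrum.norm_le_norm_of_mem hx
    exact abs_le.mp (h1.trans ((Nat.le_ceil _).trans (Nat.cast_le.mpr hk)))
  · have h1 : IsSelfAdjoint (cfc Real.sqrt a) := cfc_predicate _ _
    rw [h1.star_eq, ← cfc_mul _ _ a]
    conv_rhs => rw [← cfc_id' ℝ a]
    exact cfc_congr fun x hx => Real.mul_self_sqrt (spectrum_nonneg_of_nonneg h hx)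

namespace IsLocallyCStarAlgebra

variable {A Λ : Type*} [Ring A] [StarRing A] [Algebra ℂ A] [UniformSpace A] [Preorder Λ]
  {p : Λ → CStarSeminorm A}

theorem exists_tendsto (hp : IsLocallyCStarAlgebra p) (u : ℕ → A)
    (hu : ∀ l, CauchySeq fun k => (p l).toQuot (u k)) :
    ∃ a, Filter.Tendsto u Filter.atTop (𝓝 a) := by
  have := hp.isUniformAddGroup
  have := hp.completeSpace
  refine cauchySeq_tendsto_of_complete ?_
  rw [cauchySeq_iff_tendsto, uniformity_eq_comap_nhds_zero, Filter.tendsto_comap_iff,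
    hp.withSeminorms.tendsto_nhds]
  intro l ε hε
  obtain ⟨N, hN⟩ := Metric.cauchySeq_iff.mp (hu l) ε hε
  filter_upwards [Filter.eventually_ge_atTop (N, N)] with z hz
  have := hN z.2 hz.2 z.1 hz.1
  rw [dist_eq_norm, sub_eq_add_neg, ← neg_one_smul ℂ ((p l).toQuot _), ← (p l).toQuot_smul,
    ← (p l).toQuot_add, (p l).norm_toQuot, neg_one_smul, ← sub_eq_add_neg] at this
  simpa using this

theorem continuous_of_norm_le (hp : IsLocallyCStarAlgebra p) {E : Type*} [NormedAddCommGroup E]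
    [Module ℂ E] (f : A →ₗ[ℂ] E) (l : Λ) (hf : ∀ a, ‖f a‖ ≤ p l a) : Continuous f := by
  have := hp.isUniformAddGroup
  refine continuous_of_continuousAt_zero f ?_
  rw [ContinuousAt, map_zero]
  refine squeeze_zero_norm hf ?_
  exact (hp.withSeminorms.continuous_seminorm l).tendsto' 0 0 (map_zero (p l).toSeminorm)

theorem continuous_starAlgHom (hp : IsLocallyCStarAlgebra p) {K : Type*} [NormedAddCommGroup K]
    [InnerProductSpace ℂ K] [CompleteSpace K] (π : A →⋆ₐ[ℂ] (K →L[ℂ] K)) {l : Λ}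
    (hπ : ∀ a, ‖π a‖ ≤ p l a) : Continuous π :=
  hp.continuous_of_norm_le π.toAlgHom.toLinearMap l hπ

variable [StarModule ℂ A]

theorem continuous_toQuot (hp : IsLocallyCStarAlgebra p) (l : Λ) : Continuous (p l).toQuot :=
  hp.continuous_of_norm_le (p l).toQuotHom.toAlgHom.toLinearMap l
    fun a => ((p l).norm_toQuot a).le

/-- Positivity in `M_n(A_l)` of the image of a hermitian matrix is positivity in `M_n(A)` up to an
`l`-null matrix. -/
theorem matrixNonneg_of_nonneg (hp : IsLocallyCStarAlgebra p) (l : Λ) {n : ℕ}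
    {M : Matrix (Fin n) (Fin n) A} (hM : IsSelfAdjoint M) (h : 0 ≤ (p l).matrixHom n M) :
    (p l).MatrixNonneg n M := by
  obtain ⟨P, hP⟩ := exists_polynomial_seq_near_sqrt
  -- Convergence needs only self-adjointness, so it holds at every index `m`; positivity is
  -- available at `l` alone. By completeness the entries therefore converge in `A`, and the limit
  -- squares to `M` modulo an `l`-null matrix.
  have hlim (m : Λ) := exists_tendsto_aeval_of_near_sqrt hP (hM.map ((p m).matrixHom n))
  choose c hc hc2 using hlim
  let b (k : ℕ) : Matrix (Fin n) (Fin n) A := Polynomial.aeval M ((P k).map (algebraMap ℝ ℂ))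
  have hb (m : Λ) (i j : Fin n) :
      Filter.Tendsto (fun k => (p m).toQuot (b k i j)) Filter.atTop (𝓝 (c m i j)) := by
    have h1 := ((continuous_apply_apply (ρ := fun _ _ => (p m).Quot) i j).tendsto (c m)).comp
      (hc m)
    refine h1.congr fun k => ?_
    exact congrFun (congrFun (Polynomial.aeval_algHom_apply ((p m).matrixHom n) M
      ((P k).map (algebraMap ℝ ℂ))) i) j
  have hB (i j : Fin n) := hp.exists_tendsto (fun k => b k i j) fun m => (hb m i j).cauchySeq
  choose B hB using hB
  have hBc (m : Λ) : (p m).matrixHom n (Matrix.of B) = c m := by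
    ext i j
    exact tendsto_nhds_unique (((hp.continuous_toQuot m).tendsto _).comp (hB i j)) (hb m i j)
  refine ⟨Matrix.of B, M - star (Matrix.of B) * Matrix.of B, ?_, by abel⟩
  rw [CStarSeminorm.matrixSeminorm_eq, map_sub, map_mul, map_star, hBc, hc2 l h, sub_self,
    norm_zero]

end IsLocallyCStarAlgebra

/-! ### Block operators and their quadratic forms. -/

section BlockOperator

variable {H : Type*} [NormedAddCommGroup H] [InnerProductSpace ℂ H]

theorem inner_blockOperator {n : ℕ} (M : Matrix (Fin n) (Fin n) (H →L[ℂ] H))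
    (x y : PiLp 2 fun _ : Fin n => H) :
    ⟪x, blockOperator n M y⟫_ℂ = ∑ i, ∑ j, ⟪x i, M i j (y j)⟫_ℂ := by
  simp [blockOperator, PiLp.inner_apply, inner_sum]

theorem blockOperator_eq_zero {n : ℕ} {M : Matrix (Fin n) (Fin n) (H →L[ℂ] H)}
    (h : ∀ i j, M i j = 0) : blockOperator n M = 0 := by
  ext1 y
  refine ext_inner_left ℂ fun x => ?_
  rw [inner_blockOperator]
  simp [h]

theorem isSelfAdjoint_of_isPositive_blockOperator_one [CompleteSpace H] {T : H →L[ℂ] H}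
    (h : (blockOperator 1 (Matrix.of fun _ _ => T)).IsPositive) : IsSelfAdjoint T := by
  rw [ContinuousLinearMap.isSelfAdjoint_iff_isSymmetric]
  intro x y
  have := h.isSymmetric (WithLp.toLp 2 fun _ => x) (WithLp.toLp 2 fun _ => y)
  rw [← inner_conj_symm] at this
  simp only [ContinuousLinearMap.coe_coe, inner_blockOperator] at this
  simpa using this

theorem blockOperator_one_eq_zero {T : H →L[ℂ] H}
    (h : blockOperator 1 (Matrix.of fun _ _ => T) = 0) : T = 0 := by
  ext1 y
  refine ext_inner_left ℂ fun x => ?_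
  have := inner_blockOperator (Matrix.of fun _ _ => T) (WithLp.toLp 2 fun _ : Fin 1 => x)
    (WithLp.toLp 2 fun _ => y)
  rw [h] at this
  simpa using this.symm

end BlockOperator

/-! ### Local completely positive maps. -/

section LocalCP

variable {A Λ : Type*} [Ring A] [StarRing A] [Algebra ℂ A] [StarModule ℂ A]
  {p : Λ → CStarSeminorm A} {H : Type*} [NormedAddCommGroup H] [InnerProductSpace ℂ H]

/-- Compressions of local representations are local completely positive. -/
theorem isLocalCP_of_compression {K : Type*} [NormedAddCommGroup K] [InnerProductSpace ℂ K]
    [CompleteSpace K] (σ : A →⋆ₐ[ℂ] (K →L[ℂ] K)) {l : Λ} (hσ : ∀ a, ‖σ a‖ ≤ p l a)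
    (X : H → K) (φ : A →ₗ[ℂ] (H →L[ℂ] H)) (hφ : ∀ a x y, ⟪X x, σ a (X y)⟫_ℂ = ⟪x, φ a y⟫_ℂ) :
    IsLocalCP p φ := by
  have hnull {a : A} (ha : p l a = 0) : φ a = 0 := by
    ext1 y
    refine ext_inner_left ℂ fun x => ?_
    have : σ a = 0 := norm_le_zero_iff.mp (ha ▸ hσ a)
    rw [← hφ, this]
    simp
  refine ⟨l, fun n M => ⟨?_, fun h => blockOperator_eq_zero fun i j =>
    hnull ((p l).eq_zero_of_matrixSeminorm_eq_zero h i j)⟩⟩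
  rintro ⟨b, c, hc, rfl⟩
  have key (x : PiLp 2 fun _ : Fin n => H) :
      ⟪x, blockOperator n ((star b * b + c).map φ) x⟫_ℂ =
        ((∑ k, ‖∑ j, σ (b k j) (X (x j))‖ ^ 2 : ℝ) : ℂ) := by
    rw [← sum_inner_star_mul_self σ b fun j => X (x j), inner_blockOperator]
    refine Finset.sum_congr rfl fun i _ => Finset.sum_congr rfl fun j _ => ?_
    rw [Matrix.map_apply, Matrix.add_apply, map_add,
      hnull ((p l).eq_zero_of_matrixSeminorm_eq_zero hc i j), add_zero, hφ]
  rw [ContinuousLinearMap.isPositive_iff_complex]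
  intro x
  have hx : 0 ≤ ∑ k, ‖∑ j, σ (b k j) (X (x j))‖ ^ 2 := by positivity
  rw [← inner_conj_symm, key, Complex.conj_ofReal]
  generalize (∑ k, ‖∑ j, σ (b k j) (X (x j))‖ ^ 2) = r at hx
  exact ⟨by simp, by simpa using hx⟩

variable [CompleteSpace H] {φ : A →ₗ[ℂ] (H →L[ℂ] H)}

/-- Elements `b⋆ b` have self-adjoint images; polarize with `b = 1`, `a`, `1 + a`, `1 + i a`. -/
theorem IsLocalCP.map_star (h : IsLocalCP p φ) (a : A) : φ (star a) = star (φ a) := by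
  obtain ⟨l, hl⟩ := h
  have hsq (b : A) : star (φ (star b * b)) = φ (star b * b) := by
    refine isSelfAdjoint_of_isPositive_blockOperator_one
      ((hl 1 (Matrix.of fun _ _ => star b * b)).1 ⟨Matrix.of fun _ _ => b, 0, ?_, ?_⟩)
    · rw [CStarSeminorm.matrixSeminorm_eq, map_zero, norm_zero]
    · ext i j
      simp [Matrix.mul_apply]
  have h0 := hsq a
  have h1 := hsq (1 + a)
  have h2 := congrArg (Complex.I • ·) (hsq (1 + Complex.I • a))
  have h3 := hsq 1
  simp only [star_add, star_one, star_smul, add_mul, mul_add, one_mul, mul_one, map_add,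
    mul_smul_comm, map_smul, Complex.star_def, Complex.conj_I, smul_smul, map_neg, neg_smul,
    smul_neg, neg_neg, Complex.I_mul_I, one_smul, smul_add, star_neg, neg_mul,
    smul_mul_assoc] at h0 h1 h2 h3
  linear_combination (norm := module) (-1 / 2 : ℂ) • (h1 - h3 - h0) -
    (1 / 2 : ℂ) • (h2 - Complex.I • h3 - Complex.I • h0)

/-- Converts local complete positivity to the real-part form that `CStarSeminorm.exists_dilation`
takes. -/
theorem IsLocalCP.exists_index (hp : ∀ l : Λ, ∀ (n : ℕ) (M : Matrix (Fin n) (Fin n) A),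
      IsSelfAdjoint M → 0 ≤ (p l).matrixHom n M → (p l).MatrixNonneg n M) (h : IsLocalCP p φ) :
    ∃ l : Λ, (∀ a, p l a = 0 → φ a = 0) ∧ ∀ (n : ℕ) (M : Matrix (Fin n) (Fin n) A),
      0 ≤ (p l).matrixHom n M + star ((p l).matrixHom n M) →
      ∀ x : Fin n → H, 0 ≤ (∑ i, ∑ j, ⟪x i, φ (M i j) (x j)⟫_ℂ).re := by
  obtain ⟨l, hl⟩ := id h
  refine ⟨l, fun a ha => blockOperator_one_eq_zero ((hl 1 (Matrix.of fun _ _ => a)).2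
    (((p l).matrixSeminorm_one_eq_zero_iff a).mpr ha)), fun n M hM x => ?_⟩
  rw [← StarHomClass.map_star, ← map_add] at hM
  have h1 := ((hl n _).1 (hp l n _ (IsSelfAdjoint.add_star_self M) hM)).re_inner_nonneg_right
    (WithLp.toLp 2 x)
  rw [inner_blockOperator] at h1
  have h2 := sum_inner_add_star φ h.map_star M x
  have h3 : 0 ≤ (∑ i, ∑ j, ⟪x i, φ ((M + star M) i j) (x j)⟫_ℂ).re := h1
  linarith

end LocalCP

/-! ### Isometries that intertwine representations. -/

section Intertwining

variable {A : Type*} [Ring A] [StarRing A] [Algebra ℂ A]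
  {H : Type*} [NormedAddCommGroup H] [InnerProductSpace ℂ H] [CompleteSpace H]
  {K : Type*} [NormedAddCommGroup K] [InnerProductSpace ℂ K] [CompleteSpace K]

/-- An isometry that compresses a representation to a representation intertwines the two. -/
theorem apply_isometry_eq_of_compression (σ : A →⋆ₐ[ℂ] (K →L[ℂ] K)) (π : A →⋆ₐ[ℂ] (H →L[ℂ] H))
    (X : H →ₗᵢ[ℂ] K) (h : ∀ a x y, ⟪X x, σ a (X y)⟫_ℂ = ⟪x, π a y⟫_ℂ) (a : A) (y : H) :
    σ a (X y) = X (π a y) := by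
  -- Apply the compression identity to `a⋆ a`, using that `π` is multiplicative. With the cross
  -- terms this gives `‖σ(a) X y - X π(a) y‖² = 0`.
  have h1 : ⟪σ a (X y), σ a (X y)⟫_ℂ = ⟪π a y, π a y⟫_ℂ := by
    rw [← ContinuousLinearMap.adjoint_inner_right, ← ContinuousLinearMap.star_eq_adjoint,
      ← map_star, ← mul_apply_eq_comp, ← map_mul, h, map_mul, mul_apply_eq_comp, map_star,
      ContinuousLinearMap.star_eq_adjoint, ContinuousLinearMap.adjoint_inner_right]
  have h2 : ⟪σ a (X y), X (π a y)⟫_ℂ = ⟪π a y, π a y⟫_ℂ := by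
    rw [← inner_conj_symm, h, inner_conj_symm]
  rw [← sub_eq_zero, ← inner_self_eq_zero (𝕜 := ℂ), inner_sub_left, inner_sub_right,
    inner_sub_right, h1, h2, h, X.inner_map_map]
  ring

/-- A representation that leaves the range of an isometry invariant restricts to it. -/
theorem exists_restrict_of_isometry (σ : A →⋆ₐ[ℂ] (K →L[ℂ] K)) (V : H →ₗᵢ[ℂ] K)
    (h : ∀ a y, ∃ w, V w = σ a (V y)) :
    ∃ π : A →⋆ₐ[ℂ] (H →L[ℂ] H), ∀ a y, V (π a y) = σ a (V y) := by
  let Vc : H →L[ℂ] K := V.toContinuousLinearMap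
  let f (a : A) : H →L[ℂ] H := ContinuousLinearMap.adjoint Vc ∘L σ a ∘L Vc
  have hV (w : H) : ContinuousLinearMap.adjoint Vc (V w) = w := by
    refine ext_inner_left ℂ fun z => ?_
    rw [ContinuousLinearMap.adjoint_inner_right]
    exact V.inner_map_map z w
  have hf (a : A) (y : H) : V (f a y) = σ a (V y) := by
    obtain ⟨w, hw⟩ := h a y
    change V (ContinuousLinearMap.adjoint Vc (σ a (V y))) = _
    rw [← hw, hV]
  refine ⟨{ toFun := f, map_one' := ?_, map_mul' := ?_, map_zero' := ?_, map_add' := ?_,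
            commutes' := ?_, map_star' := ?_ }, hf⟩
  · ext1 y
    apply V.injective
    simp [hf]
  · intro a b
    ext1 y
    apply V.injective
    simp [hf]
  · ext1 y
    apply V.injective
    simp [hf]
  · intro a b
    ext1 y
    apply V.injective
    simp [hf]
  · intro r
    ext1 y
    apply V.injective
    simp [hf, Algebra.algebraMap_eq_smul_one]
  · intro a
    ext1 y
    refine ext_inner_left ℂ fun x => ?_
    rw [ContinuousLinearMap.star_eq_adjoint, ContinuousLinearMap.adjoint_inner_right,
      ← V.inner_map_map, ← V.inner_map_map, hf, hf, map_star,
      ContinuousLinearMap.star_eq_adjoint, ContinuousLinearMap.adjoint_inner_right]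

end Intertwining

/-! ### Passing from a generating operator system to the algebra. -/

section Generation

variable {A Λ : Type*} [Ring A] [StarRing A] [Algebra ℂ A] [StarModule ℂ A]

theorem LocalOperatorSystem.Generates.induction [TopologicalSpace A] {S : LocalOperatorSystem A}
    (hS : S.Generates) {P : A → Prop} (hclosed : IsClosed {a | P a}) (mem : ∀ s ∈ S.carrier, P s)
    (add : ∀ a b, P a → P b → P (a + b)) (mul : ∀ a b, P a → P b → P (a * b))
    (star : ∀ a, P a → P (star a)) (a : A) : P a := by
  have h : (StarAlgebra.adjoin ℂ (S.carrier : Set A) : Set A) ⊆ {a | P a} := fun x hx => by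
    induction hx using StarAlgebra.adjoin_induction with
    | mem x hx => exact mem x hx
    | algebraMap r =>
      refine mem _ ?_
      rw [Algebra.algebraMap_eq_smul_one]
      exact S.smul_mem r S.one_mem'
    | add x y _ _ hx hy => exact add x y hx hy
    | mul x y _ _ hx hy => exact mul x y hx hy
    | star x _ hx => exact star x hx
  exact closure_minimal h hclosed (hS ▸ Set.mem_univ a)

variable [UniformSpace A] [Preorder Λ] {p : Λ → CStarSeminorm A} {S : LocalOperatorSystem A}
  {H : Type*} [NormedAddCommGroup H] [InnerProductSpace ℂ H] [CompleteSpace H]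

theorem IsLocallyCStarAlgebra.starAlgHom_ext (hp : IsLocallyCStarAlgebra p) (hS : S.Generates)
    {π ρ : A →⋆ₐ[ℂ] (H →L[ℂ] H)} (hπ : IsLocalRepresentation p π)
    (hρ : IsLocalRepresentation p ρ) (h : ∀ s ∈ S.carrier, π s = ρ s) : π = ρ := by
  obtain ⟨l, hl⟩ := hπ
  obtain ⟨m, hm⟩ := hρ
  refine StarAlgHom.ext (hS.induction (isClosed_eq (hp.continuous_starAlgHom π hl)
    (hp.continuous_starAlgHom ρ hm)) h (fun a b ha hb => ?_) (fun a b ha hb => ?_) fun a ha => ?_)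
  · rw [map_add, map_add, ha, hb]
  · rw [map_mul, map_mul, ha, hb]
  · rw [map_star, map_star, ha]

/-- Commutation with `π a` alone is not stable under `⋆`, so the induction also carries commutation
with `(π a)⋆`. -/
theorem IsLocallyCStarAlgebra.commute_of_commute (hp : IsLocallyCStarAlgebra p)
    (hS : S.Generates) {π : A →⋆ₐ[ℂ] (H →L[ℂ] H)} (hπ : IsLocalRepresentation p π)
    {T : H →L[ℂ] H} (h : ∀ s ∈ S.carrier, T * π s = π s * T) (a : A) : T * π a = π a * T := by
  obtain ⟨l, hl⟩ := hπ
  have hc := hp.continuous_starAlgHom π hl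
  refine (hS.induction (P := fun a => T * π a = π a * T ∧ T * star (π a) = star (π a) * T)
    ?_ (fun s hs => ⟨h s hs, ?_⟩) (fun a b ha hb => ⟨?_, ?_⟩) (fun a b ha hb => ⟨?_, ?_⟩)
    (fun a ha => ⟨?_, ?_⟩) a).1
  · exact (isClosed_eq (continuous_const.mul hc) (hc.mul continuous_const)).inter
      (isClosed_eq (continuous_const.mul hc.star) (hc.star.mul continuous_const))
  · rw [← map_star]
    exact h _ (S.star_mem' s hs)
  · rw [map_add, mul_add, add_mul, ha.1, hb.1]
  · rw [map_add, star_add, mul_add, add_mul, ha.2, hb.2]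
  · rw [map_mul, ← mul_assoc, ha.1, mul_assoc, hb.1, mul_assoc]
  · rw [map_mul, star_mul, ← mul_assoc, hb.2, mul_assoc, ha.2, mul_assoc]
  · rw [map_star, ha.2]
  · rw [map_star, star_star, ha.1]

/-- The range of an isometry is closed, so its invariance under `σ(a)` and `σ(a)⋆` passes from `S`
to the closed ⋆-subalgebra it generates. -/
theorem IsLocallyCStarAlgebra.exists_restrict (hp : IsLocallyCStarAlgebra p) (hS : S.Generates)
    {K : Type*} [NormedAddCommGroup K] [InnerProductSpace ℂ K] [CompleteSpace K]
    (σ : A →⋆ₐ[ℂ] (K →L[ℂ] K)) {l : Λ} (hσ : ∀ a, ‖σ a‖ ≤ p l a) (V : H →ₗᵢ[ℂ] K)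
    (h : ∀ s ∈ S.carrier, ∀ y, ∃ w, V w = σ s (V y)) :
    ∃ π : A →⋆ₐ[ℂ] (H →L[ℂ] H), (∀ a, ‖π a‖ ≤ p l a) ∧ ∀ a y, V (π a y) = σ a (V y) := by
  have hc := hp.continuous_starAlgHom σ hσ
  have hV : IsClosed (Set.range V) := V.isometry.isClosedEmbedding.isClosed_range
  have hr (a : A) := hS.induction (P := fun a => ∀ y, σ a (V y) ∈ Set.range V ∧
      star (σ a) (V y) ∈ Set.range V) (by
    simp only [Set.ofPred_forall]
    refine isClosed_iInter fun y => (hV.preimage ?_).inter (hV.preimage ?_)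
    · exact hc.clm_apply continuous_const
    · exact hc.star.clm_apply continuous_const) (fun s hs y => ⟨h s hs y, by
        rw [← map_star]; exact h _ (S.star_mem' s hs) y⟩)
    (fun a b ha hb y => by
      obtain ⟨⟨w, hw⟩, w', hw'⟩ := ha y
      obtain ⟨⟨z, hz⟩, z', hz'⟩ := hb y
      exact ⟨⟨w + z, by simp [hw, hz]⟩, ⟨w' + z', by simp [hw', hz']⟩⟩)
    (fun a b ha hb y => by
      obtain ⟨w, hw⟩ := (hb y).1
      obtain ⟨z, hz⟩ := (ha y).2
      refine ⟨?_, ?_⟩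
      · rw [map_mul, mul_apply_eq_comp, ← hw]
        exact (ha w).1
      · rw [map_mul, star_mul, mul_apply_eq_comp, ← hz]
        exact (hb z).2)
    (fun a ha y => by
      rw [map_star, star_star]
      exact (ha y).symm) a
  obtain ⟨π, hπ⟩ := exists_restrict_of_isometry σ V fun a y => (hr a y).1
  refine ⟨π, fun a => ContinuousLinearMap.opNorm_le_bound _ (apply_nonneg (p l).toSeminorm a)
    fun y => ?_, hπ⟩
  rw [← V.norm_map, hπ, ← V.norm_map y]
  exact (σ a).le_of_opNorm_le (hσ a) _

end Generation

/-! ### Rigidity of boundary representations and the theorem. -/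

section Main

variable {A₁ A₂ Λ H : Type*}
  [Ring A₁] [StarRing A₁] [Algebra ℂ A₁] [StarModule ℂ A₁]
  [Ring A₂] [StarRing A₂] [Algebra ℂ A₂] [StarModule ℂ A₂]
  {p : Λ → CStarSeminorm A₁} {q : Λ → CStarSeminorm A₂}
  {S₁ : LocalOperatorSystem A₁} {S₂ : LocalOperatorSystem A₂}
  {Φ : S₁.toSubmodule →ₗ[ℂ] S₂.toSubmodule}
  [NormedAddCommGroup H] [InnerProductSpace ℂ H] [CompleteSpace H]

/-- Dilations of the restriction of a local boundary representation to the operator system are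
trivial. -/
theorem IsLocalBoundaryRepresentation.apply_isometry_eq
    (hunital : Φ S₁.unit = S₂.unit) (hΦ : IsLocalCompletelyIsometric p q S₁ S₂ Φ)
    {π : A₁ →⋆ₐ[ℂ] (H →L[ℂ] H)} (hπ : IsLocalBoundaryRepresentation p S₁ π)
    {K : Type*} [NormedAddCommGroup K] [InnerProductSpace ℂ K] [CompleteSpace K]
    (σ : A₂ →⋆ₐ[ℂ] (K →L[ℂ] K)) {l : Λ} (hσ : ∀ b, ‖σ b‖ ≤ q l b) (V : H →ₗᵢ[ℂ] K)
    (hV : ∀ (s : S₁.toSubmodule) (x y : H), ⟪V x, σ (Φ s) (V y)⟫_ℂ = ⟪x, π s y⟫_ℂ)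
    (s : S₁.toSubmodule) (y : H) : σ (Φ s) (V y) = V (π s y) := by
  let ψ : S₁.toSubmodule →ₗ[ℂ] (K →L[ℂ] K) :=
    σ.toAlgHom.toLinearMap ∘ₗ S₂.toSubmodule.subtype ∘ₗ Φ
  have hψ (s : S₁.toSubmodule) : ψ s = σ (Φ s) := rfl
  obtain ⟨L, _, _, _, τ, W, hτ, hW⟩ := (p l).exists_dilation S₁.toSubmodule S₁.one_mem' ψ
    (by
      have : ψ S₁.unit = 1 := by rw [hψ, hunital]; exact map_one σ
      exact this)
    (fun s hs => norm_le_zero_iff.mp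
      ((hσ (Φ s)).trans_eq ((hΦ.apply_eq_zero_iff l s).mpr hs)))
    (fun n M hM x => (q l).re_sum_inner_nonneg σ hσ ((hΦ.nonneg_iff hunital l M).mpr hM) x)
  let X : H →ₗᵢ[ℂ] L := W.comp V
  let Xc : H →L[ℂ] L := X.toContinuousLinearMap
  let φ : A₁ →ₗ[ℂ] (H →L[ℂ] H) :=
    { toFun := fun a => ContinuousLinearMap.adjoint Xc ∘L τ a ∘L Xc
      map_add' := fun a b => by ext1 y; simp
      map_smul' := fun c a => by ext1 y; simp }
  have hφ (a : A₁) (x y : H) : ⟪X x, τ a (X y)⟫_ℂ = ⟪x, φ a y⟫_ℂ :=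
    (ContinuousLinearMap.adjoint_inner_right Xc x (τ a (X y))).symm
  -- On `S₁` the compression of `τ` by `W V` is `V⋆ σ(Φ s) V = π s`; uniqueness extends this to all
  -- of `A₁`.
  have hφπ : φ = π.toAlgHom.toLinearMap := by
    refine hπ.unique φ (isLocalCP_of_compression τ hτ X φ hφ) fun s hs => ?_
    ext1 y
    refine ext_inner_left ℂ fun x => ?_
    rw [← hφ, ← hV ⟨s, hs⟩]
    exact hW ⟨s, hs⟩ (V x) (V y)
  have hX := apply_isometry_eq_of_compression τ π X fun a x y => by
    rw [hφ, hφπ]; rfl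
  -- Compress `τ(s) W V = W V π(s)` by `W`: the left side becomes `σ(Φ s) V`, the right side `V
  -- π(s)`.
  refine ext_inner_left ℂ fun z => ?_
  rw [← hψ, ← hW]
  change ⟪W z, τ s (X y)⟫_ℂ = _
  rw [hX]
  exact W.inner_map_map z _

/-- Surjectivity of `Φ` turns rigidity into invariance of the range of `V` under `σ(S₂)`. Used
twice: to construct `π₂` and to prove its uniqueness. -/
theorem IsLocalBoundaryRepresentation.exists_restrict [UniformSpace A₂] [Preorder Λ]
    (hq : IsLocallyCStarAlgebra q) (hS₂ : S₂.Generates)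
    (hunital : Φ S₁.unit = S₂.unit) (hsurj : Function.Surjective Φ)
    (hΦ : IsLocalCompletelyIsometric p q S₁ S₂ Φ)
    {π : A₁ →⋆ₐ[ℂ] (H →L[ℂ] H)} (hπ : IsLocalBoundaryRepresentation p S₁ π)
    {K : Type*} [NormedAddCommGroup K] [InnerProductSpace ℂ K] [CompleteSpace K]
    (σ : A₂ →⋆ₐ[ℂ] (K →L[ℂ] K)) {l : Λ} (hσ : ∀ b, ‖σ b‖ ≤ q l b) (V : H →ₗᵢ[ℂ] K)
    (hV : ∀ (s : S₁.toSubmodule) (x y : H), ⟪V x, σ (Φ s) (V y)⟫_ℂ = ⟪x, π s y⟫_ℂ) :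
    ∃ ρ : A₂ →⋆ₐ[ℂ] (H →L[ℂ] H), (∀ b, ‖ρ b‖ ≤ q l b) ∧ (∀ b y, V (ρ b y) = σ b (V y)) ∧
      ∀ s : S₁.toSubmodule, ρ (Φ s) = π s := by
  have h := hπ.apply_isometry_eq hunital hΦ σ hσ V hV
  obtain ⟨ρ, hρ, hρV⟩ := hq.exists_restrict hS₂ σ hσ V fun s hs y => by
    obtain ⟨r, hr⟩ := hsurj ⟨s, hs⟩
    exact ⟨π r y, by rw [← h, hr]⟩
  refine ⟨ρ, hρ, hρV, fun s => ?_⟩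
  ext1 y
  apply V.injective
  rw [hρV, h]

end Main

theorem mainTheorem2 {A₁ A₂ Λ H : Type*}
    [Ring A₁] [StarRing A₁] [Algebra ℂ A₁] [StarModule ℂ A₁] [UniformSpace A₁]
    [Ring A₂] [StarRing A₂] [Algebra ℂ A₂] [StarModule ℂ A₂] [UniformSpace A₂]
    [PartialOrder Λ] (p : Λ → CStarSeminorm A₁) (q : Λ → CStarSeminorm A₂)
    (hp : IsLocallyCStarAlgebra p) (hq : IsLocallyCStarAlgebra q)
    (S₁ : LocalOperatorSystem A₁) (S₂ : LocalOperatorSystem A₂)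
    (hS₁ : S₁.Generates) (hS₂ : S₂.Generates)
    (Φ : S₁.toSubmodule →ₗ[ℂ] S₂.toSubmodule)
    (hunital : Φ S₁.unit = S₂.unit) (hsurj : Function.Surjective Φ)
    (hΦ : IsLocalCompletelyIsometric p q S₁ S₂ Φ)
    [NormedAddCommGroup H] [InnerProductSpace ℂ H] [CompleteSpace H] [Nontrivial H]
    (π₁ : A₁ →⋆ₐ[ℂ] (H →L[ℂ] H)) (hπ₁ : IsLocalBoundaryRepresentation p S₁ π₁) :
    ∃ π₂ : A₂ →⋆ₐ[ℂ] (H →L[ℂ] H), IsLocalBoundaryRepresentation q S₂ π₂ ∧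
      ∀ s : S₁.toSubmodule, π₂ (Φ s : A₂) = π₁ (s : A₁) := by
  obtain ⟨l, hl⟩ := hπ₁.isLocalRepresentation
  -- `ψ` plays the role of `π₁ ∘ Φ⁻¹`: if `Φ s = 0`, then `p l s = 0`, so `π₁ s = 0`.
  obtain ⟨ψ, hψ⟩ := LinearMap.exists_comp_eq_of_ker_le Φ
    (π₁.toAlgHom.toLinearMap ∘ₗ S₁.toSubmodule.subtype) fun s hs =>
      norm_le_zero_iff.mp ((hl s).trans_eq ((hΦ.apply_eq_zero_iff l s).mp (by
        rw [hs]; exact map_zero (q l).toSeminorm)))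
  replace hψ (s : S₁.toSubmodule) : ψ (Φ s) = π₁ s := hψ s
  obtain ⟨K, _, _, _, σ, V, hσ, hV⟩ := (q l).exists_dilation S₂.toSubmodule S₂.one_mem' ψ
    (by
      have : ψ S₂.unit = 1 := by rw [← hunital, hψ]; exact map_one π₁
      exact this)
    (fun s hs => by
      obtain ⟨r, rfl⟩ := hsurj s
      rw [hψ]
      exact norm_le_zero_iff.mp ((hl r).trans_eq ((hΦ.apply_eq_zero_iff l r).mp hs)))
    (fun n M hM x => by
      choose N hN using fun i j => hsurj (M i j)
      have hM' : M = Matrix.map (Matrix.of N) Φ := by ext1 i j; exact (hN i j).symm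
      subst hM'
      have h := (p l).re_sum_inner_nonneg π₁ hl
        ((hΦ.nonneg_iff hunital l (Matrix.of N)).mp hM) x
      simpa only [Matrix.map_apply, hψ] using h)
  obtain ⟨π₂, hπ₂, -, hπΦ⟩ := hπ₁.exists_restrict hq hS₂ hunital hsurj hΦ σ hσ V fun s x y => by
    rw [hV, hψ]
  refine ⟨π₂, ⟨⟨l, hπ₂⟩, fun T => ⟨fun hT => ?_, ?_⟩, ?_, fun φ hφ hφS => ?_⟩, hπΦ⟩
  · exact (hπ₁.irreducible T).mp (hp.commute_of_commute hS₁ hπ₁.isLocalRepresentation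
      fun s hs => by rw [← hπΦ ⟨s, hs⟩, hT])
  · rintro ⟨z, rfl⟩ a
    simp
  · exact isLocalCP_of_compression π₂ hπ₂ id _ fun a x y => rfl
  · obtain ⟨m, hm0, hm⟩ := hφ.exists_index fun l n M hM h => hq.matrixNonneg_of_nonneg l hM h
    -- The competitor `φ` is dilated on all of `A₂`, at its own index `m`, so that its values
    -- everywhere are compressions of `σ'`.
    obtain ⟨K', _, _, _, σ', V', hσ', hV'⟩ := (q m).exists_dilation ⊤ Submodule.mem_top
      (φ ∘ₗ (⊤ : Submodule ℂ A₂).subtype) ((hφS 1 S₂.one_mem').trans (map_one π₂))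
      (fun s hs => hm0 s hs) fun n M hM x => hm n (M.map (↑)) hM x
    replace hV' (b : A₂) (x y : H) : ⟪V' x, σ' b (V' y)⟫_ℂ = ⟪x, φ b y⟫_ℂ :=
      hV' ⟨b, Submodule.mem_top⟩ x y
    obtain ⟨ρ, hρ, hρV, hρΦ⟩ := hπ₁.exists_restrict hq hS₂ hunital hsurj hΦ σ' hσ' V'
      fun s x y => by rw [hV', hφS _ (Φ s).2, hπΦ]
    have hρπ : ρ = π₂ := hq.starAlgHom_ext hS₂ ⟨m, hρ⟩ ⟨l, hπ₂⟩ fun s hs => by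
      obtain ⟨r, hr⟩ := hsurj ⟨s, hs⟩
      have := (hρΦ r).trans (hπΦ r).symm
      rwa [hr] at this
    ext1 b
    ext1 y
    refine ext_inner_left ℂ fun x => ?_
    rw [← hV', ← hρV, V'.inner_map_map, hρπ]
    rfl
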